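/- Let $r,N\ge 0$, let $U=\mathbb R^r$ with Lebesgue measure, and let $Z=(z_1,\dots,z_N)$ be a list of vectors in $U$ from which a basis $B=(b_1,\dots,b_r)$ of $U$ has been selected as a sublist (ordered as in $Z$). For a finite list $X=(x_1,\dots,x_n)$ in $U$ write $\mathrm{cone}(X)=\{\sum_i\lambda_ix_i:\lambda_i\ge0\}$; if some linear functional is positive on all $x_i$, the multivariate spline $T_X$ is the distribution on $U$ given by $$T_X(\varphi)=\int_0^\infty\!\!\cdots\int_0^\infty \varphi\Big(\sum_{i=1}^n\lambda_ix_i\Big)\,d\lambda_1\cdots d\lambda_n .$$ The convolution of two distributions $S,T$ on $U$ is defined if $\mathrm{supp}(S)\cap(K-\mathrm{supp}(T))$ is compact for every compact $K\subseteq U$; it is $(S*T)(\varphi)=S_\xi\big(T_\eta(\alpha(\xi)\varphi(\xi+\eta))\big)$, where $\alpha$ is any test function equal to $1$ on a neighbourhood of $\mathrm{supp}(S)\cap(\mathrm{supp}(\varphi)-\mathrm{supp}(T))$; the empty convolution is $\delta_0$. For $0\le i\le r$ let $S_i=\mathrm{span}(b_1,\dots,b_i)$, oriented so that $(b_1,\dots,b_i)$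 is a positive basis. Let $P_i$ (resp. $N_i$) be the sublist of those $u$ in $Z\cap(S_i\setminus S_{i-1})$ for which the basis $(b_1,\dots,b_{i-1},u)$ of $S_i$ is positive (resp. negative). Put $$T_i^{B+}=(-1)^{|N_i|}\,T_{P_i}*T_{-N_i},\quad T_i^{B-}=(-1)^{|P_i|}\,T_{-P_i}*T_{N_i},\quad R_i^B=T_i^{B+}-T_i^{B-},\quad R^B_Z=R_1^B*\cdots*R_r^B .$$ For $c>0$ let $\tau_c=b_1+\tfrac1c b_2+\dots+\tfrac1{c^{r-1}}b_r$, and let $Z^{B+}=\bigcup_{i=1}^r(P_i,-N_i)$. Then all splines and convolutions in the definitions of $R^B_Z$ and of $T_1^{B+}*\cdots*T_r^{B+}$ are well-defined, and there is a nonzero polynomial $p\in\mathbb R[s_1,\dots,s_r]$ such that 1. $R^B_Z=p$ as distributions, i.e. $R^B_Z(\varphi)=\int_U p(x)\varphi(x)\,dx$ for every test function $\varphi$; 2. $p$ is the local piece of $T_1^{B+}*\cdots*T_r^{B+}$ near $\tau_c$ for large $c$: there are an open convex cone $C\subseteq\mathrm{cone}(Z^{B+})$ and $c_0>0$ such that $\tau_c\in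 C$ for all $c\ge c_0$, and $(T_1^{B+}*\cdots*T_r^{B+})(\varphi)=\int_U p(x)\varphi(x)\,dx$ for every test function $\varphi$ with support in $C$; 3. if $Z$ contains no zero vector, then $p$ is homogeneous of degree $N-r=|Z|-r$. -/

import Mathlib

open MeasureTheory TopologicalSpace
open scoped Distributions Pointwise Topology

namespace ZonotopalSpline

/-- The vector space `U = ℝ^r`. -/
abbrev Vec (r : ℕ) : Type := Fin r → ℝ

/-- Test functions on `ℝ^r`: compactly supported smooth functions `ℝ^r → ℝ`. -/
abbrev Test (r : ℕ) : Type := 𝓓((⊤ : Opens (Vec r)), ℝ)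

/-- Distributions on `ℝ^r`: continuous linear functionals on the test functions. -/
abbrev Distr (r : ℕ) : Type := 𝓓'((⊤ : Opens (Vec r)), ℝ)

/-- The distribution `φ ↦ ∫ φ(x) f(x) dμ(x)`, for `f` locally integrable with respect to `μ`
(and `0` if `f` is not locally integrable). -/
noncomputable def distrOfDensity {r : ℕ} (μ : Measure (Vec r)) (f : Vec r → ℝ) : Distr r :=
  (TestFunction.integralAgainstBilinCLM (ContinuousLinearMap.mul ℝ ℝ) μ f :
    Test r →L[ℝ] ℝ)

/-- The distribution `φ ↦ ∫ p(x) φ(x) dx` with which a polynomial `p` is identified. -/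
noncomputable def polyDistr {r : ℕ} (p : MvPolynomial (Fin r) ℝ) : Distr r :=
  distrOfDensity volume (fun x => MvPolynomial.eval x p)

theorem polyDistr_apply {r : ℕ} (p : MvPolynomial (Fin r) ℝ) (φ : Test r) :
    polyDistr p φ = ∫ x, φ x * MvPolynomial.eval x p := by
  have h : LocallyIntegrableOn (fun x : Vec r => MvPolynomial.eval x p)
      ((⊤ : Opens (Vec r)) : Set (Vec r)) volume :=
    ((MvPolynomial.continuous_eval p).locallyIntegrable).locallyIntegrableOn _
  exact TestFunction.integralAgainstBilinCLM_eq_integral (B := ContinuousLinearMap.mul ℝ ℝ) h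

/-! ### Cones and multivariate splines -/

/-- `cone(X)`, the set of nonnegative combinations of the list `X`. -/
def listCone {r : ℕ} {ι : Type*} [Fintype ι] (X : ι → Vec r) : Set (Vec r) :=
  {u | ∃ l : ι → ℝ, (∀ i, 0 ≤ l i) ∧ u = ∑ i, l i • X i}

/-- Some linear functional is positive on all members of the list `X`: this is the condition
under which the multivariate spline `T_X` is defined. -/
def Pointed {r : ℕ} {ι : Type*} (X : ι → Vec r) : Prop :=
  ∃ f : Vec r →ₗ[ℝ] ℝ, ∀ i, 0 < f (X i)

/-- The image of Lebesgue measure on the orthant `[0,∞)^ι` under `l ↦ ∑ i, l i • X i`. -/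
noncomputable def splineMeasure {r : ℕ} {ι : Type*} [Fintype ι] (X : ι → Vec r) :
    Measure (Vec r) :=
  ((volume : Measure (ι → ℝ)).restrict (Set.Ici 0)).map (fun l => ∑ i, l i • X i)

/-- The multivariate spline `T_X`, the distribution
`φ ↦ ∫_{[0,∞)^ι} φ (∑ i, l i • X i) dl` (see `spline_apply`). -/
noncomputable def spline {r : ℕ} {ι : Type*} [Fintype ι] (X : ι → Vec r) : Distr r :=
  distrOfDensity (splineMeasure X) (fun _ => 1)

theorem measurable_comb {r : ℕ} {ι : Type*} [Fintype ι] (X : ι → Vec r) :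
    Measurable (fun l : ι → ℝ => ∑ i, l i • X i) := by
  have : Continuous (fun l : ι → ℝ => ∑ i, l i • X i) := by fun_prop
  exact this.measurable

theorem spline_locallyIntegrable {r : ℕ} {ι : Type*} [Fintype ι] {X : ι → Vec r}
    (hX : Pointed X) :
    LocallyIntegrableOn (fun _ : Vec r => (1 : ℝ)) ((⊤ : Opens (Vec r)) : Set (Vec r))
      (splineMeasure X) := by
  obtain ⟨f, hf⟩ := hX
  have hfc : Continuous f := f.continuous_of_finiteDimensional
  apply LocallyIntegrable.locallyIntegrableOn
  rw [locallyIntegrable_iff]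
  intro K hK
  rw [integrableOn_const_iff]
  right
  obtain ⟨M, hM⟩ := (hK.image hfc).bddAbove
  rw [splineMeasure, Measure.map_apply (measurable_comb X) hK.measurableSet,
    Measure.restrict_apply (measurable_comb X hK.measurableSet)]
  refine lt_of_le_of_lt (measure_mono ?_)
    ((isCompact_Icc (a := (0 : ι → ℝ)) (b := fun i => M / f (X i))).measure_lt_top)
  rintro l ⟨hlK, hl⟩
  refine ⟨hl, fun i => ?_⟩
  have h1 : f (∑ i, l i • X i) ≤ M := hM ⟨_, hlK, rfl⟩
  rw [map_sum] at h1
  have h2 : l i * f (X i) ≤ ∑ j, f (l j • X j) := by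
    have := Finset.single_le_sum (f := fun j => f (l j • X j))
      (fun j _ => by
        simp only [map_smul, smul_eq_mul]
        exact mul_nonneg (hl j) (hf j).le) (Finset.mem_univ i)
    simpa using this
  rw [le_div_iff₀ (hf i)]
  exact h2.trans h1

/-- The formula that characterises the multivariate spline. -/
theorem spline_apply {r : ℕ} {ι : Type*} [Fintype ι] {X : ι → Vec r}
    (hX : Pointed X) (φ : Test r) :
    spline X φ = ∫ l in Set.Ici (0 : ι → ℝ), φ (∑ i, l i • X i) := by
  have h := TestFunction.integralAgainstBilinCLM_eq_integral
    (B := ContinuousLinearMap.mul ℝ ℝ) (spline_locallyIntegrable hX) (f := φ)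
  refine h.trans ?_
  rw [splineMeasure, integral_map (measurable_comb X).aemeasurable]
  · simp
  · refine Continuous.aestronglyMeasurable ?_
    simpa using φ.continuous

/-! ### Convolution of distributions -/

/-- The test function `η ↦ φ (ξ + η)`. -/
noncomputable def translate {r : ℕ} (ξ : Vec r) (φ : Test r) : Test r where
  toFun η := φ (ξ + η)
  contDiff' := φ.contDiff.comp (contDiff_const.add contDiff_id)
  hasCompactSupport' := φ.hasCompactSupport.comp_homeomorph (Homeomorph.addLeft ξ)
  tsupport_subset' := fun _ _ => trivial

/-- `α` is equal to one on a neighbourhood of `supp S ∩ (supp φ - supp T)`. -/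
def IsCutoff {r : ℕ} (S T : Distr r) (φ α : Test r) : Prop :=
  ∀ᶠ ξ in 𝓝ˢ (Distribution.dsupport S ∩ (tsupport φ - Distribution.dsupport T)), α ξ = 1

/-- `ψ` is the test function `ξ ↦ T_η (α(ξ) φ(ξ + η))`. -/
def IsPartialValue {r : ℕ} (T : Distr r) (φ α ψ : Test r) : Prop :=
  ∀ ξ, ψ ξ = T (α ξ • translate ξ φ)

/-- `R` is the convolution `S * T`: the set `supp S ∩ (K - supp T)` is compact for all compact
`K`, and `(S * T)(φ) = S_ξ (T_η (α(ξ) φ(ξ + η)))`, where `α` is a cutoff function; cutoff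
functions for which the right-hand side is defined exist, and the value does not depend on the
choice of `α`. -/
structure IsConvolution {r : ℕ} (S T R : Distr r) : Prop where
  isCompact_inter : ∀ K : Set (Vec r), IsCompact K →
    IsCompact (Distribution.dsupport S ∩ (K - Distribution.dsupport T))
  exists_cutoff : ∀ φ : Test r, ∃ α ψ : Test r, IsCutoff S T φ α ∧ IsPartialValue T φ α ψ
  apply_eq : ∀ φ α ψ : Test r, IsCutoff S T φ α → IsPartialValue T φ α ψ → R φ = S ψ

theorem IsConvolution.unique {r : ℕ} {S T R R' : Distr r} (h : IsConvolution S T R)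
    (h' : IsConvolution S T R') : R = R' := by
  refine DFunLike.ext _ _ fun φ => ?_
  obtain ⟨α, ψ, h1, h2⟩ := h.exists_cutoff φ
  rw [h.apply_eq φ α ψ h1 h2, h'.apply_eq φ α ψ h1 h2]

/-- The convolution of `S` and `T` is well-defined. -/
def Convolvable {r : ℕ} (S T : Distr r) : Prop := ∃ R, IsConvolution S T R

open Classical in
/-- The convolution `S * T` (and `0` if it is not defined). -/
noncomputable def conv {r : ℕ} (S T : Distr r) : Distr r :=
  if h : Convolvable S T then h.choose else 0

theorem IsConvolution.conv_eq {r : ℕ} {S T R : Distr r} (h : IsConvolution S T R) :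
    conv S T = R := by
  have h' : Convolvable S T := ⟨R, h⟩
  rw [conv, dif_pos h']
  exact h'.choose_spec.unique h

/-- The iterated convolution `T_1 * ⋯ * T_n` (bracketed to the left); the empty convolution is
the unit `δ_0`. -/
noncomputable def iterConv {r : ℕ} : (n : ℕ) → (Fin n → Distr r) → Distr r
  | 0, _ => Distribution.delta 0
  | n + 1, T => conv (iterConv n (fun i => T i.castSucc)) (T (Fin.last n))

/-- All the convolutions that occur in `T_1 * ⋯ * T_n` are well-defined. -/
def IterConvolvable {r : ℕ} : (n : ℕ) → (Fin n → Distr r) → Prop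
  | 0, _ => True
  | n + 1, T => IterConvolvable n (fun i => T i.castSucc) ∧
      Convolvable (iterConv n (fun i => T i.castSucc)) (T (Fin.last n))

/-! ### The construction

`b = (b_1, …, b_r)` is an ordered basis; Lean's `b i`, with `i : Fin r`, is `b_{i+1}`. -/

/-- The subspace `S_i = span {b_1, …, b_i}`. -/
def flag {r : ℕ} (b : Fin r → Vec r) (i : ℕ) : Submodule ℝ (Vec r) :=
  Submodule.span ℝ (b '' {ν | (ν : ℕ) < i})

/-- `(d_1, …, d_{i+1})` is a positive basis of `S_{i+1}`: the linear map `S_{i+1} → S_{i+1}` that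
sends `b_ν` to `d_ν` for `1 ≤ ν ≤ i + 1` has positive determinant. -/
def IsPositiveBasis {r : ℕ} (b : Fin r → Vec r) (i : Fin r) (d : Fin r → Vec r) : Prop :=
  ∃ f : flag b (i + 1) →ₗ[ℝ] flag b (i + 1),
    (∀ ν ≤ i, ∀ x : flag b (i + 1), (x : Vec r) = b ν → (f x : Vec r) = d ν) ∧
    0 < LinearMap.det f

/-- `u ∈ S_{i+1} \ S_i` is positive: `(b_1, …, b_i, u)` is a positive basis of `S_{i+1}`. -/
def IsPositive {r : ℕ} (b : Fin r → Vec r) (i : Fin r) (u : Vec r) : Prop :=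
  IsPositiveBasis b i (Function.update b i u)

open Classical in
/-- (The positions in the list `Z` of) the positive vectors in `Z ∩ (S_{i+1} \ S_i)`. -/
noncomputable def posPart {r N : ℕ} (Z : Fin N → Vec r) (b : Fin r → Vec r) (i : Fin r) :
    Finset (Fin N) :=
  {k | Z k ∈ flag b (i + 1) ∧ Z k ∉ flag b i ∧ IsPositive b i (Z k)}

open Classical in
/-- (The positions in the list `Z` of) the negative vectors in `Z ∩ (S_{i+1} \ S_i)`. -/
noncomputable def negPart {r N : ℕ} (Z : Fin N → Vec r) (b : Fin r → Vec r) (i : Fin r) :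
    Finset (Fin N) :=
  {k | Z k ∈ flag b (i + 1) ∧ Z k ∉ flag b i ∧ ¬ IsPositive b i (Z k)}

/-- The sublist of `Z` on the positions `A`. -/
def sub {r N : ℕ} (Z : Fin N → Vec r) (A : Finset (Fin N)) : A → Vec r := fun k => Z k

/-- `T_i^{B+} = (-1)^{|N_i|} T_{P_i} * T_{-N_i}`. -/
noncomputable def Tplus {r N : ℕ} (Z : Fin N → Vec r) (b : Fin r → Vec r) (i : Fin r) :
    Distr r :=
  ((-1 : ℝ) ^ (negPart Z b i).card) •
    conv (spline (sub Z (posPart Z b i))) (spline (-sub Z (negPart Z b i)))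

/-- `T_i^{B-} = (-1)^{|P_i|} T_{-P_i} * T_{N_i}`. -/
noncomputable def Tminus {r N : ℕ} (Z : Fin N → Vec r) (b : Fin r → Vec r) (i : Fin r) :
    Distr r :=
  ((-1 : ℝ) ^ (posPart Z b i).card) •
    conv (spline (-sub Z (posPart Z b i))) (spline (sub Z (negPart Z b i)))

/-- `R_i^B = T_i^{B+} - T_i^{B-}`. -/
noncomputable def Rfactor {r N : ℕ} (Z : Fin N → Vec r) (b : Fin r → Vec r) (i : Fin r) :
    Distr r :=
  Tplus Z b i - Tminus Z b i

/-- The distribution `R^B_Z = R_1^B * ⋯ * R_r^B`. -/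
noncomputable def RB {r N : ℕ} (Z : Fin N → Vec r) (b : Fin r → Vec r) : Distr r :=
  iterConv r (Rfactor Z b)

/-- The multivariate spline `T_1^{B+} * ⋯ * T_r^{B+}`. -/
noncomputable def TB {r N : ℕ} (Z : Fin N → Vec r) (b : Fin r → Vec r) : Distr r :=
  iterConv r (Tplus Z b)

/-- All splines and all convolutions in the construction of `R^B_Z` and of
`T_1^{B+} * ⋯ * T_r^{B+}` are well-defined. -/
structure WellDefined {r N : ℕ} (Z : Fin N → Vec r) (b : Fin r → Vec r) : Prop where
  pointed_pos : ∀ i, Pointed (sub Z (posPart Z b i))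
  pointed_neg_pos : ∀ i, Pointed (-sub Z (posPart Z b i))
  pointed_neg : ∀ i, Pointed (sub Z (negPart Z b i))
  pointed_neg_neg : ∀ i, Pointed (-sub Z (negPart Z b i))
  convolvable_plus : ∀ i,
    Convolvable (spline (sub Z (posPart Z b i))) (spline (-sub Z (negPart Z b i)))
  convolvable_minus : ∀ i,
    Convolvable (spline (-sub Z (posPart Z b i))) (spline (sub Z (negPart Z b i)))
  iterConvolvable_R : IterConvolvable r (Rfactor Z b)
  iterConvolvable_T : IterConvolvable r (Tplus Z b)

open Classical in
/-- The list `Z^{B+}`: the list `Z` with the signs of the negative vectors reversed, so that it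
consists of the `P_i` and the `-N_i` (and of the zero vectors of `Z`, if there are any). -/
noncomputable def reorient {r N : ℕ} (Z : Fin N → Vec r) (b : Fin r → Vec r) :
    Fin N → Vec r :=
  fun k => if ∃ i, k ∈ negPart Z b i then -Z k else Z k

/-- The vector `τ = b_1 + c⁻¹ b_2 + ⋯ + c^{-(r-1)} b_r`. -/
noncomputable def tau {r : ℕ} (b : Fin r → Vec r) (c : ℝ) : Vec r :=
  ∑ i : Fin r, (1 / c ^ (i : ℕ)) • b i

/-- The distribution `T` agrees on the open set `C` with the polynomial `p`. -/
def AgreesOn {r : ℕ} (T : Distr r) (p : MvPolynomial (Fin r) ℝ) (C : Set (Vec r)) : Prop :=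
  ∀ φ : Test r, tsupport φ ⊆ C → T φ = polyDistr p φ

/-- `p` is the local piece of `T_1^{B+} * ⋯ * T_r^{B+}` near `τ`: the two agree on an open convex
cone inside `cone(Z^{B+})` that contains `τ` for all large `c`. -/
def IsLocalPieceNearTau {r N : ℕ} (Z : Fin N → Vec r) (b : Fin r → Vec r)
    (p : MvPolynomial (Fin r) ℝ) : Prop :=
  ∃ C : ConvexCone ℝ (Vec r), IsOpen (C : Set (Vec r)) ∧
    (C : Set (Vec r)) ⊆ listCone (reorient Z b) ∧
    (∃ c₀ : ℝ, 0 < c₀ ∧ ∀ c ≥ c₀, tau b c ∈ C) ∧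
    AgreesOn (TB Z b) p C

end ZonotopalSpline

namespace ZonotopalSpline

/-! By induction on `i`, the convolution of the first `i` factors of `R` is a polynomial density `p`
with respect to a translation invariant measure `μ` on `S_i`.

Let `l` be the coordinate functional of the next basis vector `b`, let `Y` be the list `(P, -N)` of
the next layer, and let `n` be its length. In polar coordinates `w = t • ω`, with `ω` normalised by
`l (∑ ω k • Y k) = 1`, the vectors `t • b` and `t • ∑ ω k • Y k` differ by an element of `S_i`.
Translation invariance of `μ` absorbs that difference. Convolving `p` with the spline of `Y` thus
gives, on the half-space `l > 0`, the density `slice`: `l(z)^(n-1)` times the average of `p(z - l(z)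
• ∑ ω k • Y k)` over `ω`. The opposite spline gives the same expression on `l < 0`, up to a sign
that the sign in `R` cancels (`slice_neg`). So `integral_mul_integral_orthant_sub` yields one
formula on all of `S_{i+1}`. It is a polynomial, and its degree has grown by `n - 1`
(`exists_eval_eq_slice`).

The factors `T⁺` convolve to a signed spline of the joined list. On a cone where the coordinates are
positive and decrease fast, subtracting the contribution of the last layer leads back into such a
cone one level lower (`exists_narrowCone_sub`). Only the half-space `l > 0` matters there, so the
same recursion produces the same `p` (`AgreesOnNarrowCone.succ`). The cone contains `τ_c` for large
`c`. Slices of positive functions are positive (`slice_pos`), so `p`, up to sign, is positive on the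
cone and hence nonzero.

On the whole space `μ` is a nonzero multiple of Lebesgue measure, and the constant goes into the
polynomial. -/

/-! ### Test functions and supports -/

/-- The product of a test function with a smooth function. -/
noncomputable def smoothMul {r : ℕ} (f : Vec r → ℝ) (hf : ContDiff ℝ (⊤ : ℕ∞) f) (φ : Test r) :
    Test r where
  toFun x := f x * φ x
  contDiff' := hf.mul φ.contDiff
  hasCompactSupport' := φ.hasCompactSupport.mul_left
  tsupport_subset' := fun _ _ => trivial

@[simp]
theorem smoothMul_apply {r : ℕ} (f : Vec r → ℝ) (hf : ContDiff ℝ (⊤ : ℕ∞) f) (φ : Test r)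
    (x : Vec r) : smoothMul f hf φ x = f x * φ x := rfl

@[simp]
theorem translate_apply {r : ℕ} (ξ : Vec r) (φ : Test r) (η : Vec r) :
    translate ξ φ η = φ (ξ + η) := rfl

/-- A bump function as a test function. -/
noncomputable def bump {r : ℕ} {c : Vec r} (f : ContDiffBump c) : Test r where
  toFun := f
  contDiff' := f.contDiff
  hasCompactSupport' := f.hasCompactSupport
  tsupport_subset' := fun _ _ => trivial

/-- There are test functions that are equal to one near a given bounded set. -/
theorem exists_test_one_nhds {r : ℕ} {K : Set (Vec r)} (hK : Bornology.IsBounded K) :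
    ∃ α : Test r, ∀ᶠ x in 𝓝ˢ K, α x = 1 := by
  obtain ⟨R, hR⟩ := hK.subset_ball 0
  have hR' : (0 : ℝ) < |R| + 1 := by positivity
  refine ⟨bump (⟨|R| + 1, |R| + 2, hR', by linarith⟩ : ContDiffBump (0 : Vec r)), ?_⟩
  rw [eventually_nhdsSet_iff_exists]
  refine ⟨Metric.ball 0 R, Metric.isOpen_ball, hR, fun x hx => ?_⟩
  apply ContDiffBump.one_of_mem_closedBall
  have : dist x 0 < R := hx
  simp only [Metric.mem_closedBall]
  linarith [le_abs_self R]

/-- A distribution vanishes on the test functions whose support does not meet its own. -/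
theorem apply_eq_zero_of_disjoint {r : ℕ} (T : Distr r) (φ : Test r)
    (h : Disjoint (tsupport φ) (Distribution.dsupport T)) : T φ = 0 := by
  -- Compactness of the support upgrades local vanishing: a single smooth `χ` is one on it, and `T`
  -- kills every multiple of `χ`.
  have key : ∃ (χ : Vec r → ℝ) (hχ : ContDiff ℝ (⊤ : ℕ∞) χ), (∀ x ∈ tsupport φ, χ x = 1) ∧
      ∀ ψ : Test r, T (smoothMul χ hχ ψ) = 0 := by
    refine IsCompact.induction_on (s := tsupport φ)
      (p := fun s => ∃ (χ : Vec r → ℝ) (hχ : ContDiff ℝ (⊤ : ℕ∞) χ), (∀ x ∈ s, χ x = 1) ∧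
        ∀ ψ : Test r, T (smoothMul χ hχ ψ) = 0) φ.hasCompactSupport.isCompact ?_ ?_ ?_ ?_
    · refine ⟨fun _ => 0, contDiff_const, by simp, fun ψ => ?_⟩
      have : smoothMul (fun _ => 0) contDiff_const ψ = 0 := by ext x; simp
      rw [this, map_zero]
    · rintro s t hst ⟨χ, hχ, h1, h2⟩
      exact ⟨χ, hχ, fun x hx => h1 x (hst hx), h2⟩
    · rintro s t ⟨χ, hχ, h1, h2⟩ ⟨χ', hχ', h1', h2'⟩
      -- This is `1 - (1 - χ)(1 - χ')`, which equals one wherever either function does.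
      refine ⟨fun x => χ x + χ' x - χ x * χ' x, (hχ.add hχ').sub (hχ.mul hχ'), ?_, fun ψ => ?_⟩
      · rintro x (hx | hx)
        · simp [h1 x hx]
        · simp [h1' x hx]
      · have : smoothMul (fun x => χ x + χ' x - χ x * χ' x) ((hχ.add hχ').sub (hχ.mul hχ')) ψ =
            smoothMul χ hχ ψ + smoothMul χ' hχ' ψ - smoothMul χ hχ (smoothMul χ' hχ' ψ) := by
          ext x
          simp
          ring
        rw [this, map_sub, map_add, h2, h2', h2]
        simp
    · intro x hx
      have hx' : x ∉ Distribution.dsupport T := fun h' => h.le_bot ⟨hx, h'⟩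
      rw [Distribution.notMem_dsupport_iff] at hx'
      obtain ⟨s, hs, hso, hxs⟩ := hx'
      obtain ⟨ε, hε, hεs⟩ := Metric.isOpen_iff.1 hso x hxs
      let f : ContDiffBump x := ⟨ε / 4, ε / 2, by linarith, by linarith⟩
      refine ⟨Metric.ball x (ε / 4), mem_nhdsWithin_of_mem_nhds
        (Metric.ball_mem_nhds x (by linarith)), f, f.contDiff, fun y hy => ?_, fun ψ => ?_⟩
      · exact f.one_of_mem_closedBall (Metric.ball_subset_closedBall hy)
      · refine hs _ ?_
        have h1 : tsupport (smoothMul f f.contDiff ψ) ⊆ tsupport f :=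
          tsupport_mul_subset_left
        refine h1.trans ?_
        rw [f.tsupport_eq]
        refine (Metric.closedBall_subset_ball ?_).trans hεs
        change ε / 2 < ε
        linarith
  obtain ⟨χ, hχ, h1, h2⟩ := key
  have : φ = smoothMul χ hχ φ := by
    ext x
    by_cases hx : x ∈ tsupport φ
    · simp [h1 x hx]
    · simp [image_eq_zero_of_notMem_tsupport hx]
  rw [this, h2]

/-- If the translates of `φ` do not vanish under `T`, then the translation lies in
`supp φ - supp T`. -/
theorem apply_translate_eq_zero {r : ℕ} (T : Distr r) (φ : Test r) {ξ : Vec r}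
    (h : ξ ∉ tsupport φ - Distribution.dsupport T) : T (translate ξ φ) = 0 := by
  refine apply_eq_zero_of_disjoint T _ (Set.disjoint_left.2 fun η hη hη' => h ?_)
  refine ⟨ξ + η, ?_, η, hη', by simp⟩
  exact tsupport_comp_subset_preimage φ (f := fun η => ξ + η) (by fun_prop) hη

/-- The hypothesis concerns test functions vanishing pointwise on `A`, the form that suits
functionals given by integrals over `A`. -/
theorem dsupport_subset {r : ℕ} {T : Distr r} {A : Set (Vec r)} (hA : IsClosed A)
    (h : ∀ φ : Test r, (∀ x ∈ A, φ x = 0) → T φ = 0) : Distribution.dsupport T ⊆ A := by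
  refine Set.sInter_subset_of_mem ⟨fun φ hφ => h φ fun x hx => ?_, hA⟩
  exact image_eq_zero_of_notMem_tsupport fun hx' => hφ hx' hx

/-- A criterion for `R` to be the convolution of `S` and `T`. -/
theorem isConvolution_of_forall {r : ℕ} {S T R : Distr r} {A B : Set (Vec r)}
    (hA : Distribution.dsupport S ⊆ A) (hB : Distribution.dsupport T ⊆ B)
    (hAB : ∀ K : Set (Vec r), IsCompact K → Bornology.IsBounded (A ∩ (K - B)))
    (hT : ∀ φ : Test r, ContDiff ℝ (⊤ : ℕ∞) fun ξ => T (translate ξ φ))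
    (hR : ∀ φ ψ : Test r, (∀ ξ ∈ A, ψ ξ = T (translate ξ φ)) → R φ = S ψ) :
    IsConvolution S T R := by
  have hcl (K : Set (Vec r)) (hK : IsCompact K) : IsClosed (K - Distribution.dsupport T) := by
    rw [sub_eq_add_neg]
    exact (Distribution.isClosed_dsupport (f := T)).neg.add_left_of_isCompact hK
  have hexists (φ : Test r) : ∃ α : Test r, ∀ᶠ ξ in 𝓝ˢ (A ∩ (tsupport φ - B)), α ξ = 1 :=
    exists_test_one_nhds (hAB _ φ.hasCompactSupport.isCompact)
  have hsub (φ : Test r) : Distribution.dsupport S ∩ (tsupport φ - Distribution.dsupport T) ⊆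
      A ∩ (tsupport φ - B) :=
    Set.inter_subset_inter hA (Set.sub_subset_sub_left hB)
  have hpv (φ α : Test r) : IsPartialValue T φ α (smoothMul _ (hT φ) α) := fun ξ => by
    rw [map_smul, smoothMul_apply, smul_eq_mul, mul_comm]
  refine ⟨fun K hK => ?_, fun φ => ?_, fun φ α ψ hα hψ => ?_⟩
  · refine Metric.isCompact_of_isClosed_isBounded
      ((Distribution.isClosed_dsupport (f := S)).inter (hcl K hK)) ((hAB K hK).subset ?_)
    exact Set.inter_subset_inter hA (Set.sub_subset_sub_left hB)
  · obtain ⟨α, hα⟩ := hexists φ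
    exact ⟨α, _, hα.filter_mono (nhdsSet_mono (hsub φ)), hpv φ α⟩
  -- The given cutoff is compared with `β`, which is one near the larger set built from `A` and `B`.
  -- The partial value of `β` satisfies the premise of `hR`, because `T` kills the translates by
  -- vectors outside `supp φ - B`.
  · obtain ⟨β, hβ⟩ := hexists φ
    have hβ1 := hR φ (smoothMul _ (hT φ) β) fun ξ hξ => by
      by_cases h : ξ ∈ tsupport φ - B
      · rw [smoothMul_apply, hβ.self_of_nhdsSet ξ ⟨hξ, h⟩, mul_one]
      · rw [smoothMul_apply, apply_translate_eq_zero T φ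
          fun h' => h (Set.sub_subset_sub_left hB h'), zero_mul]
    rw [hβ1, ← sub_eq_zero, ← map_sub]
    refine apply_eq_zero_of_disjoint S _ (Set.disjoint_left.2 fun ξ hξ hξS => ?_)
    refine notMem_tsupport_iff_eventuallyEq.2 ?_ hξ
    have hψ' (y : Vec r) : ψ y = α y * T (translate y φ) := by
      rw [hψ y, map_smul, smul_eq_mul]
    -- Near a point of `supp S`, either both cutoffs are one, or the point has a neighbourhood off
    -- the closed set `supp φ - supp T`, where both partial values vanish.
    by_cases h : ξ ∈ tsupport φ - Distribution.dsupport T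
    · filter_upwards [hα.filter_mono (nhds_le_nhdsSet (Set.mem_inter hξS h)),
        hβ.filter_mono (nhds_le_nhdsSet (hsub φ ⟨hξS, h⟩))] with y hy hy'
      simp [hψ', hy, hy']
    · filter_upwards [(hcl _ φ.hasCompactSupport.isCompact).isOpen_compl.mem_nhds h] with y hy
      simp [hψ', apply_translate_eq_zero T φ hy]

/-! ### Splines -/

theorem distrOfDensity_apply {r : ℕ} {μ : Measure (Vec r)} {f : Vec r → ℝ}
    (hf : LocallyIntegrable f μ) (φ : Test r) : distrOfDensity μ f φ = ∫ x, φ x * f x ∂μ :=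
  TestFunction.integralAgainstBilinCLM_eq_integral (B := ContinuousLinearMap.mul ℝ ℝ)
    (hf.locallyIntegrableOn _)

theorem Pointed.neg {r : ℕ} {ι : Type*} {X : ι → Vec r} (hX : Pointed X) : Pointed (-X) := by
  obtain ⟨f, hf⟩ := hX
  exact ⟨-f, fun i => by simpa using hf i⟩

theorem sum_smul_neg {E ι : Type*} [AddCommGroup E] [Module ℝ E] [Fintype ι] (X : ι → E)
    (l : ι → ℝ) : ∑ i, l i • (-X) i = -∑ i, l i • X i := by
  simp

/-- The condition `‖x‖ ≤ M * f x` passes to nonnegative combinations. The closed cone it describes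
serves as a convenient upper bound for the support of a spline. -/
theorem norm_sum_smul_le {E ι : Type*} [NormedAddCommGroup E] [NormedSpace ℝ E] [Fintype ι]
    {X : ι → E} {f : E →ₗ[ℝ] ℝ} {M : ℝ} (hM : ∀ i, ‖X i‖ ≤ M * f (X i)) {l : ι → ℝ}
    (hl : l ∈ Set.Ici 0) : ‖∑ i, l i • X i‖ ≤ M * f (∑ i, l i • X i) := by
  rw [map_sum, Finset.mul_sum]
  refine (norm_sum_le _ _).trans (Finset.sum_le_sum fun i _ => ?_)
  have h0 : 0 ≤ l i := hl i
  rw [norm_smul, Real.norm_of_nonneg h0, map_smul, smul_eq_mul]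
  nlinarith [mul_le_mul_of_nonneg_left (hM i) h0]

theorem exists_norm_le_mul {E ι : Type*} [NormedAddCommGroup E] [NormedSpace ℝ E] [Finite ι]
    {X : ι → E} {f : E →ₗ[ℝ] ℝ} (hf : ∀ i, 0 < f (X i)) :
    ∃ M : ℝ, 0 ≤ M ∧ ∀ i, ‖X i‖ ≤ M * f (X i) := by
  have := Fintype.ofFinite ι
  refine ⟨∑ i, ‖X i‖ / f (X i), Finset.sum_nonneg fun i _ => div_nonneg (norm_nonneg _) (hf i).le,
    fun i => ?_⟩
  rw [← div_le_iff₀ (hf i)]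
  exact Finset.single_le_sum (f := fun i => ‖X i‖ / f (X i))
    (fun i _ => div_nonneg (norm_nonneg _) (hf i).le) (Finset.mem_univ i)

theorem isClosed_norm_le_mul {r : ℕ} (f : Vec r →ₗ[ℝ] ℝ) (M : ℝ) :
    IsClosed {x : Vec r | ‖x‖ ≤ M * f x} :=
  isClosed_le continuous_norm (continuous_const.mul f.continuous_of_finiteDimensional)

theorem dsupport_spline_subset {r : ℕ} {ι : Type*} [Fintype ι] {X : ι → Vec r} (hX : Pointed X)
    {f : Vec r →ₗ[ℝ] ℝ} {M : ℝ} (hM : ∀ i, ‖X i‖ ≤ M * f (X i)) :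
    Distribution.dsupport (spline X) ⊆ {x | ‖x‖ ≤ M * f x} := by
  refine dsupport_subset (isClosed_norm_le_mul f M) fun φ hφ => ?_
  rw [spline_apply hX]
  exact setIntegral_eq_zero_of_forall_eq_zero fun l hl => hφ _ (norm_sum_smul_le hM hl)

/-- As a function of `ξ` this is the convolution of `φ` with the locally finite measure
`splineMeasure (-X)`, so it inherits the smoothness of `φ`. -/
theorem contDiff_spline_translate {r : ℕ} {ι : Type*} [Fintype ι] {X : ι → Vec r}
    (hX : Pointed X) (φ : Test r) :
    ContDiff ℝ (⊤ : ℕ∞) fun ξ => spline X (translate ξ φ) := by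
  have h := φ.hasCompactSupport.contDiff_convolution_right (ContinuousLinearMap.mul ℝ ℝ)
    (locallyIntegrableOn_univ.1 (spline_locallyIntegrable hX.neg)) φ.contDiff
  convert h using 1
  ext ξ
  rw [spline_apply hX, convolution_def, splineMeasure,
    integral_map (measurable_comb (-X)).aemeasurable]
  · simp
  · refine Continuous.aestronglyMeasurable ?_
    have := φ.continuous
    simp only [ContinuousLinearMap.mul_apply', one_mul]
    fun_prop

theorem spline_translate {r : ℕ} {ι : Type*} [Fintype ι] {X : ι → Vec r}
    (hX : Pointed X) (φ : Test r) (ξ : Vec r) :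
    spline X (translate ξ φ) = ∫ l in Set.Ici (0 : ι → ℝ), φ (ξ + ∑ i, l i • X i) := by
  rw [spline_apply hX]
  rfl

/-- For `x = k - y` in the set, `f y ≥ 0` gives `f x ≤ f k`, which is bounded on `K`; then `‖x‖ ≤ M
* f x` bounds `x`. -/
theorem isBounded_inter_sub {r : ℕ} {f : Vec r →ₗ[ℝ] ℝ} {M M' : ℝ} (hM : 0 ≤ M)  (hM' : 0 ≤ M')
    {K : Set (Vec r)} (hK : IsCompact K) :
    Bornology.IsBounded ({x : Vec r | ‖x‖ ≤ M * f x} ∩ (K - {x | ‖x‖ ≤ M' * f x})) := by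
  obtain ⟨a, ha⟩ := (hK.image f.continuous_of_finiteDimensional).bddAbove
  refine Metric.isBounded_closedBall (x := (0 : Vec r)) (r := M * a) |>.subset ?_
  rintro _ ⟨hx, k, hk, y, hy, rfl⟩
  simp only [Set.mem_ofPred_eq] at hx hy
  have h1 : f k ≤ a := ha ⟨k, hk, rfl⟩
  rw [mem_closedBall_zero_iff]
  refine hx.trans (mul_le_mul_of_nonneg_left ?_ hM)
  have h2 : 0 ≤ f y := by
    by_contra hneg
    have : ‖y‖ ≤ 0 := hy.trans (mul_nonpos_of_nonneg_of_nonpos hM' (not_le.1 hneg).le)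
    rw [norm_le_zero_iff] at this
    simp [this] at hneg
  rw [map_sub]
  linarith

/-- A continuous function that vanishes almost everywhere off a compact set is integrable. -/
theorem integrable_of_ae_notMem_compact {X : Type*} [TopologicalSpace X] [T2Space X]
    [MeasurableSpace X] [BorelSpace X] {m : Measure X} [IsFiniteMeasureOnCompacts m]
    {F : X → ℝ} (hF : Continuous F) {K : Set X} (hK : IsCompact K)
    (h : ∀ᵐ x ∂m, x ∉ K → F x = 0) : Integrable F m := by
  have h1 : IntegrableOn F K m := hF.continuousOn.integrableOn_compact hK
  refine (h1.integrable_indicator hK.measurableSet).congr ?_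
  filter_upwards [h] with x hx
  by_cases hxK : x ∈ K
  · simp [hxK]
  · simp [hxK, hx hxK]

theorem setIntegral_Ici_sumElim {ι κ : Type*} [Fintype ι] [Fintype κ] (g : (ι → ℝ) × (κ → ℝ) → ℝ)
    (hg : Integrable g ((volume.restrict (Set.Ici (0 : ι → ℝ))).prod
      (volume.restrict (Set.Ici (0 : κ → ℝ))))) :
    ∫ l in Set.Ici (0 : ι ⊕ κ → ℝ), g (fun i => l (Sum.inl i), fun j => l (Sum.inr j)) =
      ∫ x in Set.Ici (0 : ι → ℝ), ∫ y in Set.Ici (0 : κ → ℝ), g (x, y) := by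
  rw [← integral_prod g hg, Measure.prod_restrict]
  have h := volume_measurePreserving_sumPiEquivProdPi (fun _ : ι ⊕ κ => ℝ)
  have h2 := h.setIntegral_preimage_emb (MeasurableEquiv.measurableEmbedding _) g
    (Set.Ici (0 : ι → ℝ) ×ˢ Set.Ici (0 : κ → ℝ))
  rw [← Measure.volume_eq_prod, ← h2]
  congr 2
  ext l
  simp [Pi.le_def]
  rfl

/-- A functional positive on both lists bounds every coefficient of a combination lying in the
support of `φ`, so the integrand lives on a compact box. -/
theorem integrable_comp_sum_add_sum {r : ℕ} {ι κ : Type*} [Fintype ι] [Fintype κ]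
    {X : ι → Vec r} {Y : κ → Vec r} (h : Pointed (Sum.elim X Y)) {φ : Vec r → ℝ}
    (hφ : Continuous φ) (hφc : HasCompactSupport φ) :
    Integrable (fun q : (ι → ℝ) × (κ → ℝ) => φ (∑ i, q.1 i • X i + ∑ j, q.2 j • Y j))
      ((volume.restrict (Set.Ici (0 : ι → ℝ))).prod
        (volume.restrict (Set.Ici (0 : κ → ℝ)))) := by
  obtain ⟨f, hf⟩ := h
  have hfX : ∀ i, 0 < f (X i) := fun i => hf (Sum.inl i)
  have hfY : ∀ j, 0 < f (Y j) := fun j => hf (Sum.inr j)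
  obtain ⟨a, ha⟩ := (hφc.isCompact.image f.continuous_of_finiteDimensional).bddAbove
  rw [Measure.prod_restrict]
  refine integrable_of_ae_notMem_compact (by fun_prop)
    (K := Set.Icc 0 (fun i => a / f (X i)) ×ˢ Set.Icc 0 (fun j => a / f (Y j)))
    (isCompact_Icc.prod isCompact_Icc) ?_
  filter_upwards [ae_restrict_mem (measurableSet_Ici.prod measurableSet_Ici)]
  rintro ⟨l, l'⟩ ⟨hl, hl'⟩ hn
  by_contra hne
  have h2 : f (∑ i, l i • X i + ∑ j, l' j • Y j) ≤ a := ha ⟨_, subset_tsupport _ hne, rfl⟩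
  simp only [map_add, map_sum, map_smul, smul_eq_mul] at h2
  have h3 : ∀ i ∈ Finset.univ, 0 ≤ l i * f (X i) := fun i _ => mul_nonneg (hl i) (hfX i).le
  have h4 : ∀ j ∈ Finset.univ, 0 ≤ l' j * f (Y j) := fun j _ => mul_nonneg (hl' j) (hfY j).le
  refine hn ⟨⟨hl, fun i => ?_⟩, ⟨hl', fun j => ?_⟩⟩
  · rw [le_div_iff₀ (hfX i)]
    have := Finset.single_le_sum h3 (Finset.mem_univ i)
    linarith [Finset.sum_nonneg h4]
  · rw [le_div_iff₀ (hfY j)]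
    have := Finset.single_le_sum h4 (Finset.mem_univ j)
    linarith [Finset.sum_nonneg h3]

theorem setIntegral_orthant_sumElim {r : ℕ} {ι κ : Type*} [Fintype ι] [Fintype κ]
    {X : ι → Vec r} {Y : κ → Vec r} (h : Pointed (Sum.elim X Y)) {φ : Vec r → ℝ}
    (hφ : Continuous φ) (hφc : HasCompactSupport φ) :
    ∫ l in Set.Ici (0 : ι ⊕ κ → ℝ), φ (∑ k, l k • Sum.elim X Y k) =
      ∫ x in Set.Ici (0 : ι → ℝ), ∫ y in Set.Ici (0 : κ → ℝ),
        φ (∑ i, x i • X i + ∑ j, y j • Y j) := by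
  rw [← setIntegral_Ici_sumElim (fun q => φ (∑ i, q.1 i • X i + ∑ j, q.2 j • Y j))
    (integrable_comp_sum_add_sum h hφ hφc)]
  simp

/-- With the second list outermost, the inner integral is that of a translate of `φ` over the first
list, to which an induction hypothesis applies. -/
theorem setIntegral_orthant_sumElim_symm {r : ℕ} {ι κ : Type*} [Fintype ι] [Fintype κ]
    {X : ι → Vec r} {Y : κ → Vec r} (h : Pointed (Sum.elim X Y)) {φ : Vec r → ℝ}
    (hφ : Continuous φ) (hφc : HasCompactSupport φ) :
    ∫ l in Set.Ici (0 : ι ⊕ κ → ℝ), φ (∑ k, l k • Sum.elim X Y k) =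
      ∫ y in Set.Ici (0 : κ → ℝ), ∫ x in Set.Ici (0 : ι → ℝ),
        φ (∑ i, x i • X i + ∑ j, y j • Y j) := by
  rw [setIntegral_orthant_sumElim h hφ hφc]
  exact integral_integral_swap
    (f := fun (x : ι → ℝ) (y : κ → ℝ) => φ (∑ i, x i • X i + ∑ j, y j • Y j))
    (integrable_comp_sum_add_sum h hφ hφc)

/-- The convolution of the splines of two lists is the spline of the joint list. -/
theorem isConvolution_spline {r : ℕ} {ι κ : Type*} [Fintype ι] [Fintype κ] {X : ι → Vec r}
    {Y : κ → Vec r} (h : Pointed (Sum.elim X Y)) :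
    IsConvolution (spline X) (spline Y) (spline (Sum.elim X Y)) := by
  obtain ⟨f, hf⟩ := id h
  have hfX : ∀ i, 0 < f (X i) := fun i => hf (Sum.inl i)
  have hfY : ∀ j, 0 < f (Y j) := fun j => hf (Sum.inr j)
  have hX : Pointed X := ⟨f, hfX⟩
  have hY : Pointed Y := ⟨f, hfY⟩
  obtain ⟨M, hM0, hM⟩ := exists_norm_le_mul hfX
  obtain ⟨M', hM0', hM'⟩ := exists_norm_le_mul hfY
  refine isConvolution_of_forall (dsupport_spline_subset hX hM) (dsupport_spline_subset hY hM')
    (fun K hK => isBounded_inter_sub hM0 hM0' hK) (contDiff_spline_translate hY)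
    fun φ ψ hψ => ?_
  rw [spline_apply h, spline_apply hX,
    setIntegral_orthant_sumElim h φ.continuous φ.hasCompactSupport]
  refine (setIntegral_congr_fun measurableSet_Ici fun l hl => ?_).symm
  rw [hψ _ (norm_sum_smul_le hM hl), spline_translate hY]

theorem dsupport_smul {r : ℕ} {c : ℝ} (hc : c ≠ 0) (T : Distr r) :
    Distribution.dsupport (c • T) = Distribution.dsupport T := by
  have h (s : Set (Vec r)) : Distribution.IsVanishingOn (c • T) s ↔
      Distribution.IsVanishingOn T s := by
    refine forall₂_congr fun φ _ => ?_
    change c * T φ = 0 ↔ T φ = 0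
    simp [hc]
  simp only [Distribution.dsupport, h]

/-- Nonzero scalars change neither supports nor admissible cutoffs, and a partial value for `d • T`
is `d` times one for `T`. -/
theorem IsConvolution.smul {r : ℕ} {S T R : Distr r} (h : IsConvolution S T R) {c d : ℝ}
    (hc : c ≠ 0) (hd : d ≠ 0) : IsConvolution (c • S) (d • T) ((c * d) • R) := by
  refine ⟨?_, fun φ => ?_, fun φ α ψ hα hψ => ?_⟩
  · simpa only [dsupport_smul hc, dsupport_smul hd] using h.isCompact_inter
  · obtain ⟨α, ψ, hα, hψ⟩ := h.exists_cutoff φ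
    refine ⟨α, d • ψ, ?_, fun ξ => ?_⟩
    · simpa only [IsCutoff, dsupport_smul hc, dsupport_smul hd] using hα
    · change d * ψ ξ = d * T _
      rw [hψ ξ]
  · have h1 := h.apply_eq φ α (d⁻¹ • ψ)
      (by simpa only [IsCutoff, dsupport_smul hc, dsupport_smul hd] using hα) fun ξ => by
        change d⁻¹ * ψ ξ = T _
        rw [hψ ξ]
        change d⁻¹ * (d * T _) = T _
        rw [inv_mul_cancel_left₀ hd]
    change c * d * R φ = c * S ψ
    rw [h1, map_smul, smul_eq_mul, mul_assoc, mul_inv_cancel_left₀ hd]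

/-! ### Polar coordinates on the orthant -/

/-- The simplex `{ω ≥ 0 | ∑ k, ω k * h k = 1}`. -/
def simplex {ι : Type*} [Fintype ι] (h : ι → ℝ) : Set (ι → ℝ) :=
  {ω | 0 ≤ ω ∧ ∑ k, ω k * h k = 1}

theorem isCompact_simplex {ι : Type*} [Fintype ι] {h : ι → ℝ} (hh : ∀ k, 0 < h k) :
    IsCompact (simplex h) := by
  refine (isCompact_Icc (a := (0 : ι → ℝ)) (b := fun k => 1 / h k)).of_isClosed_subset ?_ ?_
  · exact (isClosed_Ici (a := (0 : ι → ℝ))).inter (isClosed_eq (by fun_prop) continuous_const)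
  · rintro ω ⟨h0, h1⟩
    refine ⟨h0, fun k => ?_⟩
    rw [le_div_iff₀ (hh k), ← h1]
    exact Finset.single_le_sum (f := fun k => ω k * h k)
      (fun k _ => mul_nonneg (h0 k) (hh k).le) (Finset.mem_univ k)

/-- `κ` is the angular part of Lebesgue measure on the orthant `[0,∞)^ι` in the coordinates
`(t, ω) ↦ t • ω` with `ω` in the simplex of `h`. -/
structure IsSimplexMeasure {ι : Type*} [Fintype ι] (h : ι → ℝ) (κ : Measure (ι → ℝ)) : Prop where
  isFiniteMeasure : IsFiniteMeasure κ
  ae_mem : ∀ᵐ ω ∂κ, ω ∈ simplex h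
  integral_eq : ∀ H : (ι → ℝ) → ℝ, StronglyMeasurable H → IntegrableOn H (Set.Ici 0) →
    ∫ l in Set.Ici 0, H l =
      ∫ ω, (∫ t in Set.Ioi (0 : ℝ), t ^ (Fintype.card ι - 1) * H (t • ω)) ∂κ

/-- The origin is a null set, and its complement is measurably the product of the unit sphere and
the radial half-line with density `t ^ (dim - 1)`. -/
theorem integral_polar {E : Type*} [NormedAddCommGroup E] [NormedSpace ℝ E]
    [FiniteDimensional ℝ E] [MeasurableSpace E] [BorelSpace E] [Nontrivial E] (μ : Measure E)
    [μ.IsAddHaarMeasure] {f : E → ℝ} (hf : Integrable f μ) :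
    ∫ x, f x ∂μ = ∫ ω : Metric.sphere (0 : E) 1, (∫ t in Set.Ioi (0 : ℝ),
      t ^ (Module.finrank ℝ E - 1) * f (t • (ω : E))) ∂μ.toSphere := by
  have hmp := μ.measurePreserving_homeomorphUnitSphereProd
  have hemb := (homeomorphUnitSphereProd E).measurableEmbedding
  let G : Metric.sphere (0 : E) 1 × Set.Ioi (0 : ℝ) → ℝ := fun q => f ((q.2 : ℝ) • (q.1 : E))
  have hG : ∀ x : ({0}ᶜ : Set E), G (homeomorphUnitSphereProd E x) = f x := by
    intro x
    have : ‖(x : E)‖ ≠ 0 := norm_ne_zero_iff.2 x.2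
    simp [G, smul_smul, this]
  have hint : Integrable G (μ.toSphere.prod (Measure.volumeIoiPow (Module.finrank ℝ E - 1))) := by
    rw [← hmp.integrable_comp_emb hemb]
    have h1 : IntegrableOn f {0}ᶜ μ := hf.integrableOn
    rw [integrableOn_iff_comap_subtypeVal (measurableSet_singleton _).compl] at h1
    exact h1.congr (Filter.Eventually.of_forall fun x => (hG x).symm)
  calc ∫ x, f x ∂μ = ∫ x : ({0}ᶜ : Set E), f x ∂(μ.comap (↑)) := by
        rw [integral_subtype_comap (measurableSet_singleton _).compl f,
          restrict_compl_singleton]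
    _ = ∫ q, G q ∂(μ.toSphere.prod (Measure.volumeIoiPow (Module.finrank ℝ E - 1))) := by
        rw [← hmp.integral_comp hemb]
        exact integral_congr_ae (Filter.Eventually.of_forall fun x => (hG x).symm)
    _ = _ := by
        rw [integral_prod _ hint]
        congr 1
        ext ω
        simp only [Measure.volumeIoiPow, ENNReal.ofReal, G]
        rw [integral_withDensity_eq_integral_smul,
          integral_subtype_comap measurableSet_Ioi
            fun a : ℝ => Real.toNNReal (a ^ (Module.finrank ℝ E - 1)) • f (a • (ω : E)),
          setIntegral_congr_fun measurableSet_Ioi fun x hx => ?_]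
        · rw [NNReal.smul_def, Real.coe_toNNReal _ (pow_nonneg hx.out.le _), smul_eq_mul]
        · exact (measurable_subtype_coe.pow_const _).real_toNNReal

/-- The nonnegative part of the unit sphere is projected radially to the simplex by `ω ↦ ω / L ω`.
Rescaling the radius produces the density `(L ω)⁻¹ ^ n`, which is bounded because `1 ≤ M * L ω`
there. -/
theorem exists_isSimplexMeasure {ι : Type*} [Fintype ι] [Nonempty ι] {h : ι → ℝ}
    (hh : ∀ k, 0 < h k) : ∃ κ, IsSimplexMeasure h κ := by
  classical
  let n := Fintype.card ι
  let L : (ι → ℝ) →ₗ[ℝ] ℝ := ∑ k, h k • LinearMap.proj k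
  have hL (ω : ι → ℝ) : L ω = ∑ k, ω k * h k := by simp [L, mul_comm]
  have hLc : Continuous L := L.continuous_of_finiteDimensional
  obtain ⟨M, hM0, hM⟩ := exists_norm_le_mul (X := fun k : ι => (Pi.single k 1 : ι → ℝ)) (f := L)
    (fun k => by simp [hL, Pi.single_apply, hh])
  have hLM {ω : ι → ℝ} (hω : 0 ≤ ω) : ‖ω‖ ≤ M * L ω := by
    have h1 := norm_sum_smul_le hM (l := ω) hω
    rwa [show ∑ i, ω i • (Pi.single i 1 : ι → ℝ) = ω by
      ext j; simp [Finset.sum_apply, Pi.single_apply]] at h1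
  have hLpos {ω : Metric.sphere (0 : ι → ℝ) 1} (hω : 0 ≤ (ω : ι → ℝ)) : 1 ≤ M * L ω := by
    have := hLM hω
    rwa [show ‖(ω : ι → ℝ)‖ = 1 by simp] at this
  have hLpos' {ω : Metric.sphere (0 : ι → ℝ) 1} (hω : 0 ≤ (ω : ι → ℝ)) : 0 < L ω := by
    by_contra hneg
    have := hLpos hω
    have := mul_nonpos_of_nonneg_of_nonpos hM0 (not_lt.1 hneg)
    linarith
  let A : Set (Metric.sphere (0 : ι → ℝ) 1) := {ω | 0 ≤ (ω : ι → ℝ)}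
  have hA : MeasurableSet A := (isClosed_Ici.preimage continuous_subtype_val).measurableSet
  let w : Metric.sphere (0 : ι → ℝ) 1 → NNReal := fun ω => Real.toNNReal ((L ω)⁻¹ ^ n)
  have hw : Measurable w :=
    (((hLc.measurable.comp measurable_subtype_coe).inv).pow_const n).real_toNNReal
  let g : Metric.sphere (0 : ι → ℝ) 1 → (ι → ℝ) := fun ω => (L ω)⁻¹ • (ω : ι → ℝ)
  have hg : Measurable g :=
    ((hLc.measurable.comp measurable_subtype_coe).inv).smul measurable_subtype_coe
  let σ : Measure (Metric.sphere (0 : ι → ℝ) 1) :=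
    ((volume : Measure (ι → ℝ)).toSphere.restrict A).withDensity fun ω => w ω
  have hσ : IsFiniteMeasure σ := by
    refine isFiniteMeasure_withDensity ?_
    refine ((setLIntegral_mono' (g := fun _ => ((Real.toNNReal (M ^ n) : NNReal) : ENNReal)) hA
      fun ω hω => ?_).trans_lt ?_).ne
    · have : (L ω)⁻¹ ≤ M := by
        rw [inv_le_iff_one_le_mul₀ (hLpos' hω)]
        exact hLpos hω
      have h0 : 0 ≤ (L ω)⁻¹ := inv_nonneg.2 (hLpos' hω).le
      simp only [w]
      gcongr
    · rw [lintegral_const]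
      exact ENNReal.mul_lt_top ENNReal.coe_lt_top (measure_lt_top _ _)
  refine ⟨σ.map g, ⟨inferInstance, ?_, fun H hH hHi => ?_⟩⟩
  · have hmeas : MeasurableSet (simplex h) := (isCompact_simplex hh).measurableSet
    refine (ae_map_iff hg.aemeasurable hmeas).2 ?_
    have h1 : ∀ᵐ ω ∂((volume : Measure (ι → ℝ)).toSphere.restrict A), g ω ∈ simplex h := by
      filter_upwards [ae_restrict_mem hA] with ω hω
      refine ⟨smul_nonneg (inv_nonneg.2 (hLpos' hω).le) hω, ?_⟩
      have h2 := hL (g ω)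
      rw [← h2]
      simp [g, (hLpos' hω).ne']
    exact (withDensity_absolutelyContinuous _ _) h1
  · have hJ : StronglyMeasurable fun ω : ι → ℝ =>
        ∫ t in Set.Ioi (0 : ℝ), t ^ (n - 1) * H (t • ω) := by
      refine StronglyMeasurable.integral_prod_right
        (f := fun (ω : ι → ℝ) (t : ℝ) => t ^ (n - 1) * H (t • ω)) ?_
      refine StronglyMeasurable.mul ?_ (hH.comp_measurable ?_)
      · exact (measurable_snd.pow_const _).stronglyMeasurable
      · exact measurable_snd.smul measurable_fst
    rw [integral_map hg.aemeasurable hJ.aestronglyMeasurable,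
      integral_withDensity_eq_integral_smul hw, ← integral_indicator measurableSet_Ici,
      integral_polar volume ((integrable_indicator_iff measurableSet_Ici).2 hHi),
      ← integral_indicator hA]
    refine integral_congr_ae (Filter.Eventually.of_forall fun ω => ?_)
    simp only [Module.finrank_fintype_fun_eq_card]
    by_cases hω : ω ∈ A
    · have hω' : 0 ≤ (ω : ι → ℝ) := hω
      have hc := hLpos' hω'
      rw [Set.indicator_of_mem hω]
      have h1 : ∫ t in Set.Ioi (0 : ℝ), t ^ (n - 1) *
          Set.indicator (Set.Ici 0) H (t • (ω : ι → ℝ)) =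
          ∫ t in Set.Ioi (0 : ℝ), t ^ (n - 1) * H (t • (ω : ι → ℝ)) := by
        refine setIntegral_congr_fun measurableSet_Ioi fun t ht => ?_
        have : t • (ω : ι → ℝ) ∈ Set.Ici 0 := smul_nonneg (le_of_lt ht) hω'
        simp only [Set.indicator_of_mem this]
      -- The substitution `t ↦ t / L ω` passes from the radius measured by the norm to the radius
      -- measured by `L`. Its Jacobian and the factor `t ^ (n - 1)` together account for the weight
      -- `w`.
      have h2 := integral_comp_mul_left_Ioi
        (fun t : ℝ => t ^ (n - 1) * H (t • (ω : ι → ℝ))) 0 (inv_pos.2 hc)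
      simp only [mul_zero, inv_inv, smul_eq_mul] at h2
      have h3 : ∀ t : ℝ, ((L ω)⁻¹ * t) ^ (n - 1) * H (((L ω)⁻¹ * t) • (ω : ι → ℝ)) =
          (L ω)⁻¹ ^ (n - 1) * (t ^ (n - 1) * H (t • g ω)) := by
        intro t
        simp only [g, smul_smul, mul_pow, mul_comm t]
        ring
      simp only [h3, integral_const_mul] at h2
      have hn : n = (n - 1) + 1 := (Nat.sub_add_cancel Fintype.card_pos).symm
      have h4 : (w ω : ℝ) = (L ω)⁻¹ * (L ω)⁻¹ ^ (n - 1) := by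
        rw [← pow_succ', ← hn]
        exact Real.coe_toNNReal _ (pow_nonneg (inv_nonneg.2 hc.le) n)
      rw [h1, NNReal.smul_def, smul_eq_mul, h4, mul_assoc, h2, inv_mul_cancel_left₀ hc.ne']
    · rw [Set.indicator_of_notMem hω]
      have hω' : ¬ 0 ≤ (ω : ι → ℝ) := hω
      refine setIntegral_eq_zero_of_forall_eq_zero fun t ht => ?_
      have : t • (ω : ι → ℝ) ∉ Set.Ici 0 := fun h' => hω' fun k => by
        have := h' k
        simp only [Pi.zero_apply, Pi.smul_apply, smul_eq_mul] at this
        exact nonneg_of_mul_nonneg_right this ht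
      simp [Set.indicator_of_notMem this]

/-! ### Measures on subspaces -/

/-- `μ` is a translation invariant Radon measure on the subspace `S`, regarded as a measure on
the ambient space. -/
structure IsLayer {E : Type*} [NormedAddCommGroup E] [NormedSpace ℝ E] [MeasurableSpace E]
    (S : Submodule ℝ E) (μ : Measure E) : Prop where
  ae_mem : ∀ᵐ x ∂μ, x ∈ S
  measurePreserving : ∀ s ∈ S, MeasurePreserving (fun x => s + x) μ μ
  isFiniteMeasureOnCompacts : IsFiniteMeasureOnCompacts μ

/-- The image of the product of `μ` and Lebesgue measure under `(x, t) ↦ x + t • b`. -/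
noncomputable def extend {E : Type*} [NormedAddCommGroup E] [NormedSpace ℝ E]
    [MeasurableSpace E] (μ : Measure E) (b : E) : Measure E :=
  (μ.prod volume).map fun q : E × ℝ => q.1 + q.2 • b

section

variable {E : Type*} [NormedAddCommGroup E] [NormedSpace ℝ E]

theorem isLayer_bot [FiniteDimensional ℝ E] [MeasurableSpace E] [BorelSpace E] : IsLayer
    (⊥ : Submodule ℝ E) (Measure.dirac 0) where
  ae_mem := by simp [ae_dirac_eq]
  measurePreserving s hs := by
    rw [Submodule.mem_bot] at hs
    simp only [hs, zero_add]
    exact MeasurePreserving.id _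
  isFiniteMeasureOnCompacts := inferInstance

theorem measurable_add_smul [FiniteDimensional ℝ E] [MeasurableSpace E] [BorelSpace E] (b : E) :
    Measurable fun q : E × ℝ => q.1 + q.2 • b := by
  have : Continuous fun q : E × ℝ => q.1 + q.2 • b := by fun_prop
  exact this.measurable

theorem IsLayer.integral_add [MeasurableSpace E] [BorelSpace E] {S : Submodule ℝ E}
    {μ : Measure E} (hμ : IsLayer S μ) {s : E}
    (hs : s ∈ S) (f : E → ℝ) : ∫ x, f (s + x) ∂μ = ∫ x, f x ∂μ :=
  (hμ.measurePreserving s hs).integral_comp (Homeomorph.addLeft s).measurableEmbedding f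

/-- Reflecting the line preserves Lebesgue measure, so the half-spaces belonging to `b` and to `-b`
can be measured by the same measure. -/
theorem extend_neg [FiniteDimensional ℝ E] [MeasurableSpace E] [BorelSpace E] {μ : Measure E}
    [SFinite μ] (b : E) : extend μ (-b) = extend μ b := by
  have h := ((MeasurePreserving.id μ).prod (Measure.measurePreserving_neg (volume : Measure ℝ)))
  rw [extend, extend, ← h.map_eq, Measure.map_map (measurable_add_smul b) h.measurable, h.map_eq]
  congr 1
  ext q
  simp

theorem IsLayer.sigmaFinite [FiniteDimensional ℝ E] [MeasurableSpace E] {S : Submodule ℝ E}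
    {μ : Measure E} (hμ : IsLayer S μ) :
    SigmaFinite μ := by
  have := hμ.isFiniteMeasureOnCompacts
  infer_instance

/-- The points of the form `x + t • b`, with `x ∈ S`, that lie in a given compact set, stay in a
compact set. -/
theorem exists_compact_of_add_smul_mem [FiniteDimensional ℝ E] {S : Submodule ℝ E} {b : E}
    {l : E →ₗ[ℝ] ℝ} (hb : l b = 1)
    (hS : ∀ s ∈ S, l s = 0) {K : Set E} (hK : IsCompact K) :
    ∃ K' : Set (E × ℝ), IsCompact K' ∧ ∀ x ∈ S, ∀ t : ℝ, x + t • b ∈ K → (x, t) ∈ K' := by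
  have hl : Continuous l := l.continuous_of_finiteDimensional
  refine ⟨(fun z => (z - l z • b, l z)) '' K, hK.image (by fun_prop), fun x hx t hxt =>
    ⟨_, hxt, ?_⟩⟩
  simp [hb, hS x hx]

/-- A translation by `s + t • b` acts on the two factors of the product separately. Compact sets
keep finite measure because `l` recovers the decomposition continuously. -/
theorem isLayer_extend [FiniteDimensional ℝ E] [MeasurableSpace E] [BorelSpace E]
    {S S' : Submodule ℝ E} {μ : Measure E} (hμ : IsLayer S μ) {b : E}
    {l : E →ₗ[ℝ] ℝ} (hb : l b = 1) (hS : ∀ s ∈ S, l s = 0)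
    (hS' : ∀ x, x ∈ S' ↔ ∃ s ∈ S, ∃ t : ℝ, x = s + t • b) : IsLayer S' (extend μ b) := by
  have := hμ.sigmaFinite
  have := hμ.isFiniteMeasureOnCompacts
  have hae : ∀ᵐ q ∂(μ.prod (volume : Measure ℝ)), q.1 ∈ S :=
    Measure.quasiMeasurePreserving_fst.ae hμ.ae_mem
  refine ⟨?_, fun s hs => ⟨measurable_const_add s, ?_⟩, ⟨fun K hK => ?_⟩⟩
  · refine (ae_map_iff (measurable_add_smul b).aemeasurable
      S'.closed_of_finiteDimensional.measurableSet).2 ?_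
    filter_upwards [hae] with q hq
    exact (hS' _).2 ⟨q.1, hq, q.2, rfl⟩
  · obtain ⟨s, hs', t, rfl⟩ := (hS' _).1 hs
    have h := (hμ.measurePreserving s hs').prod (measurePreserving_add_left (volume : Measure ℝ) t)
    rw [extend, Measure.map_map (measurable_const_add _) (measurable_add_smul b)]
    conv_rhs => rw [← h.map_eq, Measure.map_map (measurable_add_smul b) h.measurable]
    congr 1
    ext q
    simp only [Function.comp_apply, Prod.map]
    module
  · obtain ⟨K', hK', h⟩ := exists_compact_of_add_smul_mem hb hS hK
    rw [extend, Measure.map_apply (measurable_add_smul b) hK.measurableSet]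
    refine (measure_mono_ae ?_).trans_lt hK'.measure_lt_top
    filter_upwards [hae] with q hq hqK
    exact h q.1 hq q.2 hqK

/-! ### Convolving a density on a subspace with a spline -/

/-- The density of the convolution of a spline with a density on a subspace. -/
noncomputable def slice {ι : Type*} [Fintype ι] (l : E →ₗ[ℝ] ℝ) (Y : ι → E)
    (κ : Measure (ι → ℝ)) (p : E → ℝ) (z : E) : ℝ :=
  l z ^ (Fintype.card ι - 1) *
    ∫ ω in simplex fun k => l (Y k), p (z - l z • ∑ k, ω k • Y k) ∂κ

/-- The argument of `p` and the simplex do not change when `l` and `Y` both change sign; only the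
power of `l` does. This is what lets one formula serve both half-spaces. -/
theorem slice_neg {ι : Type*} [Fintype ι] (l : E →ₗ[ℝ] ℝ) (Y : ι → E)
    (κ : Measure (ι → ℝ)) (p : E → ℝ) (z : E) :
    slice (-l) (-Y) κ p z = (-1) ^ (Fintype.card ι - 1) * slice l Y κ p z := by
  simp only [slice, LinearMap.neg_apply, Pi.neg_apply, map_neg, neg_neg, smul_neg,
    Finset.sum_neg_distrib, neg_smul]
  rw [← mul_assoc, ← mul_pow, neg_one_mul]

theorem continuous_slice [FiniteDimensional ℝ E] {ι : Type*} [Fintype ι] {l : E →ₗ[ℝ] ℝ} {Y : ι → E}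
    (hpos : ∀ k, 0 < l (Y k)) {κ : Measure (ι → ℝ)} [IsFiniteMeasure κ] {p : E → ℝ}
    (hp : Continuous p) : Continuous (slice l Y κ p) := by
  have hl : Continuous l := l.continuous_of_finiteDimensional
  refine (hl.pow _).mul ?_
  exact continuous_parametric_integral_of_continuous (by fun_prop) (isCompact_simplex hpos)

theorem IsLayer.integrable_mul_comp_add_sum [FiniteDimensional ℝ E] [MeasurableSpace E]
    [BorelSpace E] {ι : Type*} [Fintype ι] {S : Submodule ℝ E}
    {μ : Measure E} (hμ : IsLayer S μ) {l : E →ₗ[ℝ] ℝ} (hS : ∀ s ∈ S, l s = 0) {Y : ι → E}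
    (hpos : ∀ k, 0 < l (Y k)) {p φ : E → ℝ} (hp : Continuous p) (hφ : Continuous φ)
    (hφc : HasCompactSupport φ) :
    Integrable (fun q : E × (ι → ℝ) => p q.1 * φ (q.1 + ∑ k, q.2 k • Y k))
      (μ.prod (volume.restrict (Set.Ici (0 : ι → ℝ)))) := by
  have := hμ.sigmaFinite
  have := hμ.isFiniteMeasureOnCompacts
  have hl : Continuous l := l.continuous_of_finiteDimensional
  obtain ⟨a, ha⟩ := (hφc.isCompact.image hl).bddAbove
  let D : Set (ι → ℝ) := Set.Icc 0 (fun k => a / l (Y k))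
  have hD : IsCompact D := isCompact_Icc
  let K : Set (E × (ι → ℝ)) :=
    (fun q : E × (ι → ℝ) => (q.1 - ∑ k, q.2 k • Y k, q.2)) '' (tsupport φ ×ˢ D)
  have hK : IsCompact K := (hφc.isCompact.prod hD).image (by fun_prop)
  refine integrable_of_ae_notMem_compact (by fun_prop) hK ?_
  have h1 : ∀ᵐ q ∂(μ.prod (volume.restrict (Set.Ici (0 : ι → ℝ)))), q.1 ∈ S :=
    Measure.quasiMeasurePreserving_fst.ae hμ.ae_mem
  have h2 : ∀ᵐ q ∂(μ.prod (volume.restrict (Set.Ici (0 : ι → ℝ)))), q.2 ∈ Set.Ici (0 : ι → ℝ) :=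
    Measure.quasiMeasurePreserving_snd.ae (ae_restrict_mem measurableSet_Ici)
  filter_upwards [h1, h2]
  rintro ⟨x, w⟩ hx hw hn
  by_contra hne
  have hmem : x + ∑ k, w k • Y k ∈ tsupport φ := subset_tsupport _ (right_ne_zero_of_mul hne)
  refine hn ⟨(x + ∑ k, w k • Y k, w), ⟨hmem, hw, fun k => ?_⟩, by simp⟩
  have h3 : l (x + ∑ k, w k • Y k) ≤ a := ha ⟨_, hmem, rfl⟩
  simp only [map_add, map_sum, map_smul, smul_eq_mul, hS x hx, zero_add] at h3
  rw [le_div_iff₀ (hpos k)]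
  exact (Finset.single_le_sum (f := fun k => w k * l (Y k))
    (fun k _ => mul_nonneg (hw k) (hpos k).le) (Finset.mem_univ k)).trans h3

/-- The convolution of a density on `S` with a spline is the density `slice` on the half-space. -/
theorem IsLayer.integral_mul_integral_orthant [FiniteDimensional ℝ E] [MeasurableSpace E]
    [BorelSpace E] {ι : Type*} [Fintype ι] {S : Submodule ℝ E}
    {μ : Measure E} (hμ : IsLayer S μ) {b : E} {l : E →ₗ[ℝ] ℝ} (hb : l b = 1)
    (hS : ∀ s ∈ S, l s = 0) {Y : ι → E} (hY : ∀ k, Y k - l (Y k) • b ∈ S)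
    (hpos : ∀ k, 0 < l (Y k)) {κ : Measure (ι → ℝ)}
    (hκ : IsSimplexMeasure (fun k => l (Y k)) κ) {p φ : E → ℝ} (hp : Continuous p)
    (hφ : Continuous φ) (hφc : HasCompactSupport φ) :
    ∫ x, (p x * ∫ w in Set.Ici (0 : ι → ℝ), φ (x + ∑ k, w k • Y k)) ∂μ =
      ∫ z in {z | 0 < l z}, slice l Y κ p z * φ z ∂extend μ b := by
  have := hμ.sigmaFinite
  have := hμ.isFiniteMeasureOnCompacts
  have := hκ.isFiniteMeasure
  have hl : Continuous l := l.continuous_of_finiteDimensional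
  have hint := hμ.integrable_mul_comp_add_sum hS hpos hp hφ hφc
  have hΔ := isCompact_simplex hpos
  let n := Fintype.card ι
  let F : (ι → ℝ) × (E × ℝ) → ℝ := fun q => q.2.2 ^ (n - 1) *
    (p (q.2.1 + q.2.2 • b - q.2.2 • ∑ k, q.1 k • Y k) * φ (q.2.1 + q.2.2 • b))
  have hF : Continuous F := by fun_prop
  have hFint : Integrable F ((κ.restrict (simplex fun k => l (Y k))).prod
      (μ.prod (volume.restrict (Set.Ioi (0 : ℝ))))) := by
    obtain ⟨K', hK', h⟩ := exists_compact_of_add_smul_mem hb hS hφc.isCompact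
    refine integrable_of_ae_notMem_compact hF (hΔ.prod hK') ?_
    have h1 : ∀ᵐ q ∂(μ.prod (volume.restrict (Set.Ioi (0 : ℝ)))), q.1 ∈ S :=
      Measure.quasiMeasurePreserving_fst.ae hμ.ae_mem
    have h2 := (Measure.quasiMeasurePreserving_snd
      (μ := κ.restrict (simplex fun k => l (Y k)))).ae h1
    have h3 := (Measure.quasiMeasurePreserving_fst
      (ν := μ.prod (volume.restrict (Set.Ioi (0 : ℝ))))).ae
      (ae_restrict_mem (μ := κ) hΔ.measurableSet)
    filter_upwards [h2, h3]
    rintro ⟨ω, x, t⟩ hx hω hn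
    by_contra hne
    refine hn ⟨hω, h x hx t (subset_tsupport _ ?_)⟩
    exact right_ne_zero_of_mul (right_ne_zero_of_mul hne)
  have hH : StronglyMeasurable fun w : ι → ℝ => ∫ x, p x * φ (x + ∑ k, w k • Y k) ∂μ := by
    refine StronglyMeasurable.integral_prod_right
      (f := fun (w : ι → ℝ) (x : E) => p x * φ (x + ∑ k, w k • Y k)) ?_
    refine Continuous.stronglyMeasurable ?_
    fun_prop
  -- Since `l` is one on `∑ k, ω k • Y k`, replacing `t` times this sum by `t • b` is a shift along
  -- `S`. The argument of `φ` then no longer depends on `ω`.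
  have hshift : ∀ ω ∈ simplex (fun k => l (Y k)), ∀ t : ℝ,
      ∫ x, p x * φ (x + ∑ k, (t • ω) k • Y k) ∂μ =
        ∫ x, p (x + t • b - t • ∑ k, ω k • Y k) * φ (x + t • b) ∂μ := by
    intro ω hω t
    have hs : t • b - t • ∑ k, ω k • Y k ∈ S := by
      have h1 : ∑ k, ω k • (Y k - l (Y k) • b) ∈ S :=
        S.sum_mem fun k _ => S.smul_mem _ (hY k)
      have h2 : ∑ k, ω k • (Y k - l (Y k) • b) = ∑ k, ω k • Y k - b := by
        simp only [smul_sub, Finset.sum_sub_distrib, smul_smul, ← Finset.sum_smul, hω.2, one_smul]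
      rw [h2] at h1
      have h3 := S.smul_mem (-t) h1
      convert h3 using 1
      module
    rw [← hμ.integral_add hs]
    congr 1
    ext x
    congr 2
    · module
    · simp only [Pi.smul_apply, smul_assoc, ← Finset.smul_sum]
      module
  calc ∫ x, (p x * ∫ w in Set.Ici (0 : ι → ℝ), φ (x + ∑ k, w k • Y k)) ∂μ
      = ∫ w in Set.Ici (0 : ι → ℝ), (∫ x, p x * φ (x + ∑ k, w k • Y k) ∂μ) := by
        simp_rw [← integral_const_mul]
        exact integral_integral_swap
          (f := fun (x : E) (w : ι → ℝ) => p x * φ (x + ∑ k, w k • Y k)) hint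
    _ = ∫ ω in simplex (fun k => l (Y k)),
          (∫ q, F (ω, q) ∂(μ.prod (volume.restrict (Set.Ioi 0)))) ∂κ := by
        rw [hκ.integral_eq _ hH hint.integral_prod_right,
          ← setIntegral_eq_integral_of_ae_compl_eq_zero (s := simplex fun k => l (Y k))
            (by filter_upwards [hκ.ae_mem] with ω hω hω'; exact absurd hω hω')]
        refine integral_congr_ae ?_
        filter_upwards [hFint.prod_right_ae, ae_restrict_mem hΔ.measurableSet] with ω hω hωΔ
        rw [integral_prod_symm _ hω]
        refine setIntegral_congr_fun measurableSet_Ioi fun t ht => ?_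
        simp only [F, hshift ω hωΔ, integral_const_mul]
        rfl
    _ = ∫ q, (∫ ω in simplex (fun k => l (Y k)), F (ω, q) ∂κ)
          ∂(μ.prod (volume.restrict (Set.Ioi 0))) :=
        integral_integral_swap (f := fun ω q => F (ω, q)) hFint
    _ = _ := by
        have hset : MeasurableSet {z | 0 < l z} := (isOpen_lt continuous_const hl).measurableSet
        rw [extend, Measure.restrict_map (measurable_add_smul b) hset,
          integral_map (measurable_add_smul b).aemeasurable
            (f := fun z => slice l Y κ p z * φ z)
            (Continuous.aestronglyMeasurable ((continuous_slice hpos hp).mul hφ)),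
          ← Measure.restrict_univ (μ := μ), Measure.prod_restrict, Measure.restrict_univ]
        have hae : ∀ᵐ q ∂(μ.prod (volume : Measure ℝ)), q.1 ∈ S :=
          Measure.quasiMeasurePreserving_fst.ae hμ.ae_mem
        -- For `x ∈ S` the value of `l` at `x + t • b` is `t`, so up to a null set the half-space is
        -- `t > 0`.
        have hset2 : (fun q : E × ℝ => q.1 + q.2 • b) ⁻¹' {z | 0 < l z}
            =ᵐ[μ.prod (volume : Measure ℝ)] (Set.univ ×ˢ Set.Ioi (0 : ℝ)) := by
          filter_upwards [hae] with q hq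
          have : (q ∈ (fun q : E × ℝ => q.1 + q.2 • b) ⁻¹' {z | 0 < l z}) =
              (q ∈ (Set.univ ×ˢ Set.Ioi (0 : ℝ) : Set (E × ℝ))) := by
            simp [hb, hS _ hq]
          exact this
        rw [Measure.restrict_congr_set hset2]
        refine integral_congr_ae ?_
        filter_upwards [ae_restrict_of_ae hae] with q hq
        simp only [F, slice, map_add, map_smul, hb, hS _ hq, smul_eq_mul, mul_one, zero_add,
          integral_const_mul, integral_mul_const]
        ring

/-- The convolution of a density on `S` with a difference of two opposite splines is a density
on the whole space. -/
theorem IsLayer.integral_mul_integral_orthant_sub [FiniteDimensional ℝ E] [MeasurableSpace E]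
    [BorelSpace E] {ι : Type*} [Fintype ι] [Nonempty ι]
    {S : Submodule ℝ E}
    {μ : Measure E} (hμ : IsLayer S μ) {b : E} {l : E →ₗ[ℝ] ℝ} (hb : l b = 1)
    (hS : ∀ s ∈ S, l s = 0) {Y : ι → E} (hY : ∀ k, Y k - l (Y k) • b ∈ S)
    (hpos : ∀ k, 0 < l (Y k)) {κ : Measure (ι → ℝ)}
    (hκ : IsSimplexMeasure (fun k => l (Y k)) κ) {p φ : E → ℝ} (hp : Continuous p)
    (hφ : Continuous φ) (hφc : HasCompactSupport φ) :
    ∫ x, (p x * ((∫ w in Set.Ici (0 : ι → ℝ), φ (x + ∑ k, w k • Y k)) -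
        (-1) ^ Fintype.card ι * ∫ w in Set.Ici (0 : ι → ℝ), φ (x + ∑ k, w k • (-Y) k))) ∂μ =
      ∫ z, slice l Y κ p z * φ z ∂extend μ b := by
  have := hμ.sigmaFinite
  have := hμ.isFiniteMeasureOnCompacts
  have := hκ.isFiniteMeasure
  have hl : Continuous l := l.continuous_of_finiteDimensional
  have hlneg : ∀ k, (-l) ((-Y) k) = l (Y k) := fun k => by simp
  have hposneg : ∀ k, 0 < (-l) ((-Y) k) := fun k => by rw [hlneg]; exact hpos k
  have hSneg : ∀ s ∈ S, (-l) s = 0 := fun s hs => by simp [hS s hs]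
  have hYneg : ∀ k, (-Y) k - (-l) ((-Y) k) • (-b) ∈ S := fun k => by
    rw [hlneg, Pi.neg_apply, smul_neg, ← neg_sub']
    exact S.neg_mem (hY k)
  have hκneg : IsSimplexMeasure (fun k => (-l) ((-Y) k)) κ := by simpa only [hlneg] using hκ
  have h1 := hμ.integral_mul_integral_orthant hb hS hY hpos hκ hp hφ hφc
  have h2 := hμ.integral_mul_integral_orthant (b := -b) (l := -l) (by simpa using hb) hSneg hYneg
    hposneg hκneg hp hφ hφc
  have hint1 := (hμ.integrable_mul_comp_add_sum hS hpos hp hφ hφc).integral_prod_left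
  have hint2 := (hμ.integrable_mul_comp_add_sum hSneg hposneg hp hφ hφc).integral_prod_left
  simp only [integral_const_mul] at hint1 hint2
  have hL : IsLayer (S ⊔ ℝ ∙ b) (extend μ b) := isLayer_extend hμ hb hS fun x => by
    simp only [Submodule.mem_sup, Submodule.mem_span_singleton]
    exact ⟨fun ⟨s, hs, _, ⟨t, rfl⟩, h⟩ => ⟨s, hs, t, h.symm⟩,
      fun ⟨s, hs, t, h⟩ => ⟨s, hs, _, ⟨t, rfl⟩, h.symm⟩⟩
  have := hL.isFiniteMeasureOnCompacts
  have hQ : Continuous fun z => slice l Y κ p z * φ z := (continuous_slice hpos hp).mul hφ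
  have hQint : Integrable (fun z => slice l Y κ p z * φ z) (extend μ b) :=
    hQ.integrable_of_hasCompactSupport hφc.mul_left
  rw [extend_neg] at h2
  simp only [slice_neg, mul_assoc, integral_const_mul] at h2
  simp only [mul_sub, mul_left_comm _ ((-1 : ℝ) ^ Fintype.card ι)]
  rw [integral_sub hint1 (hint2.const_mul _), integral_const_mul, h1, h2, ← mul_assoc, ← pow_add]
  -- The sign of the second spline and the sign from `slice_neg` combine to an odd power of `-1`.
  -- The difference therefore becomes a sum of integrals over the two half-spaces.
  have hn : Fintype.card ι + (Fintype.card ι - 1) = 2 * (Fintype.card ι - 1) + 1 := by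
    have : 0 < Fintype.card ι := Fintype.card_pos
    omega
  rw [hn, pow_succ, pow_mul]
  simp only [even_two, Even.neg_pow, one_pow, one_mul, neg_mul, sub_neg_eq_add]
  have hset : MeasurableSet {z | 0 < l z} := (isOpen_lt continuous_const hl).measurableSet
  rw [← integral_add_compl hset hQint]
  congr 1
  refine setIntegral_congr_set ?_
  -- The hyperplane separating the half-spaces is null.
  have hne : ∀ᵐ z ∂extend μ b, l z ≠ 0 := by
    refine (ae_map_iff (measurable_add_smul b).aemeasurable
      (isOpen_ne_fun hl continuous_const).measurableSet).2 ?_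
    have hae : ∀ᵐ q ∂(μ.prod (volume : Measure ℝ)), q.1 ∈ S :=
      Measure.quasiMeasurePreserving_fst.ae hμ.ae_mem
    have hae2 : ∀ᵐ q ∂(μ.prod (volume : Measure ℝ)), q.2 ≠ 0 :=
      Measure.quasiMeasurePreserving_snd.ae (Measure.ae_ne volume 0)
    filter_upwards [hae, hae2] with q hq hq2
    simpa [hb, hS _ hq] using hq2
  filter_upwards [hne] with z hz
  have : (z ∈ {z | 0 < (-l) z}) = (z ∈ {z | 0 < l z}ᶜ) := by
    simp only [LinearMap.neg_apply, Set.mem_ofPred_eq, Set.mem_compl_iff, not_lt, eq_iff_iff]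
    exact ⟨fun h => by linarith, fun h => by have := lt_of_le_of_ne h hz; linarith⟩
  exact this

end

/-! ### Slices of polynomials are polynomials -/

section

variable {σ τ : Type*} {R : Type*} [CommRing R]

open MvPolynomial

/-- Degrees are counted in the coefficient variables only. These will be the coordinates of `z` in
`p (z - l z • g)`, while those of `g` become the outer variables and have weight zero. -/
theorem isHomogeneous_coeff_mul [DecidableEq τ] {m n : ℕ} {P Q : MvPolynomial τ (MvPolynomial σ R)}
    (hP : ∀ k, (coeff k P).IsHomogeneous m) (hQ : ∀ k, (coeff k Q).IsHomogeneous n) (k : τ →₀ ℕ) :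
    (coeff k (P * Q)).IsHomogeneous (m + n) := by
  rw [coeff_mul]
  exact IsHomogeneous.sum _ _ _ fun x _ => (hP x.1).mul (hQ x.2)

theorem isHomogeneous_coeff_one [DecidableEq τ] (k : τ →₀ ℕ) :
    (coeff k (1 : MvPolynomial τ (MvPolynomial σ R))).IsHomogeneous 0 := by
  rw [coeff_one]
  split_ifs
  · exact isHomogeneous_one _ _
  · exact isHomogeneous_zero _ _ _

theorem isHomogeneous_coeff_pow [DecidableEq τ] {m : ℕ} {P : MvPolynomial τ (MvPolynomial σ R)}
    (hP : ∀ k, (coeff k P).IsHomogeneous m) (n : ℕ) (k : τ →₀ ℕ) :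
    (coeff k (P ^ n)).IsHomogeneous (n * m) := by
  induction n generalizing k with
  | zero => simpa using isHomogeneous_coeff_one k
  | succ n ih => rw [pow_succ, add_one_mul]; exact isHomogeneous_coeff_mul ih hP k

theorem isHomogeneous_coeff_prod [DecidableEq τ] {α : Type*} (s : Finset α) {m : α → ℕ}
    {P : α → MvPolynomial τ (MvPolynomial σ R)}
    (hP : ∀ i k, (coeff k (P i)).IsHomogeneous (m i)) (k : τ →₀ ℕ) :
    (coeff k (∏ i ∈ s, P i)).IsHomogeneous (∑ i ∈ s, m i) := by
  classical
  induction s using Finset.induction_on generalizing k with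
  | empty => simpa using isHomogeneous_coeff_one k
  | insert a s ha ih =>
    rw [Finset.prod_insert ha, Finset.sum_insert ha]
    exact isHomogeneous_coeff_mul (hP a) ih k

end

/-- A linear form as a polynomial. -/
noncomputable def linearPoly {r : ℕ} (l : Vec r →ₗ[ℝ] ℝ) : MvPolynomial (Fin r) ℝ :=
  ∑ i, MvPolynomial.C (l (Pi.single i 1)) * MvPolynomial.X i

theorem isHomogeneous_linearPoly {r : ℕ} (l : Vec r →ₗ[ℝ] ℝ) :
    (linearPoly l).IsHomogeneous 1 := by
  refine MvPolynomial.IsHomogeneous.sum _ _ _ fun i _ => ?_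
  simpa using (MvPolynomial.isHomogeneous_C _ _).mul (MvPolynomial.isHomogeneous_X ℝ i)

theorem eval_linearPoly {r : ℕ} (l : Vec r →ₗ[ℝ] ℝ) (z : Vec r) :
    MvPolynomial.eval z (linearPoly l) = l z := by
  simp only [linearPoly, map_sum, map_mul, MvPolynomial.eval_C, MvPolynomial.eval_X]
  conv_rhs => rw [pi_eq_sum_univ' z, map_sum]
  simp [mul_comm]

/-- Expanding `p (z - l z • g)` in monomials of `g` gives coefficients homogeneous of degree `d` in
`z`. Integrating over the simplex replaces the monomials by constants, their moments, and the
prefactor adds `Fintype.card ι - 1` to the degree. -/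
theorem exists_eval_eq_slice {r : ℕ} {ι : Type*} [Fintype ι] {l : Vec r →ₗ[ℝ] ℝ}
    {Y : ι → Vec r} (hpos : ∀ k, 0 < l (Y k)) (κ : Measure (ι → ℝ)) [IsFiniteMeasure κ] {d : ℕ}
    {p : MvPolynomial (Fin r) ℝ} (hp : p.IsHomogeneous d) :
    ∃ q : MvPolynomial (Fin r) ℝ, q.IsHomogeneous (Fintype.card ι - 1 + d) ∧
      ∀ z, MvPolynomial.eval z q = slice l Y κ (fun x => MvPolynomial.eval x p) z := by
  classical
  let v : Fin r → MvPolynomial (Fin r) (MvPolynomial (Fin r) ℝ) := fun i =>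
    MvPolynomial.C (MvPolynomial.X i) - MvPolynomial.C (linearPoly l) * MvPolynomial.X i
  let P : MvPolynomial (Fin r) (MvPolynomial (Fin r) ℝ) :=
    MvPolynomial.eval₂ (MvPolynomial.C.comp MvPolynomial.C) v p
  have hv (i : Fin r) (k) : (MvPolynomial.coeff k (v i)).IsHomogeneous 1 := by
    simp only [v, MvPolynomial.coeff_sub, MvPolynomial.coeff_C, MvPolynomial.coeff_C_mul,
      MvPolynomial.coeff_X, mul_ite, mul_one, mul_zero]
    refine MvPolynomial.IsHomogeneous.sub ?_ ?_
    · split_ifs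
      · exact MvPolynomial.isHomogeneous_X _ _
      · exact MvPolynomial.isHomogeneous_zero _ _ _
    · split_ifs
      · exact isHomogeneous_linearPoly l
      · exact MvPolynomial.isHomogeneous_zero _ _ _
  have hP (k) : (MvPolynomial.coeff k P).IsHomogeneous d := by
    simp only [P, MvPolynomial.eval₂_eq', MvPolynomial.coeff_sum]
    refine MvPolynomial.IsHomogeneous.sum _ _ _ fun m hm => ?_
    have hd : 0 + ∑ i, m i * 1 = d := by
      rw [← hp (MvPolynomial.mem_support_iff.1 hm)]
      simp [Finsupp.weight_apply, Finsupp.sum_fintype]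
    rw [RingHom.comp_apply, MvPolynomial.coeff_C_mul, ← hd]
    exact (MvPolynomial.isHomogeneous_C _ _).mul
      (isHomogeneous_coeff_prod _ (fun i k => isHomogeneous_coeff_pow (hv i) (m i) k) k)
  have heval (z g : Vec r) : MvPolynomial.eval (z - l z • g) p =
      ∑ k ∈ P.support, MvPolynomial.eval z (P.coeff k) * ∏ i, g i ^ k i := by
    rw [← MvPolynomial.eval₂_eq' (MvPolynomial.eval z) g P]
    rw [← MvPolynomial.coe_eval₂Hom, MvPolynomial.eval₂_comp_left, ← MvPolynomial.coe_eval₂Hom]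
    congr 1
    ext i
    · simp
    · simp [v, MvPolynomial.eval₂_sub, MvPolynomial.eval₂_mul, eval_linearPoly]
  have hg : Continuous fun ω : ι → ℝ => ∑ k, ω k • Y k := by fun_prop
  refine ⟨linearPoly l ^ (Fintype.card ι - 1) * ∑ k ∈ P.support, P.coeff k *
    MvPolynomial.C (∫ ω in simplex fun k => l (Y k), ∏ i, (∑ j, ω j • Y j) i ^ k i ∂κ), ?_,
    fun z => ?_⟩
  · refine MvPolynomial.IsHomogeneous.mul ?_ (MvPolynomial.IsHomogeneous.sum _ _ _ fun k _ => ?_)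
    · simpa using (isHomogeneous_linearPoly l).pow (Fintype.card ι - 1)
    · simpa using (hP k).mul (MvPolynomial.isHomogeneous_C _ _)
  · simp only [slice, heval, map_mul, map_pow, map_sum, eval_linearPoly, MvPolynomial.eval_C]
    rw [integral_finsetSum]
    · simp only [integral_const_mul]
    · intro k _
      refine ContinuousOn.integrableOn_compact (isCompact_simplex hpos)
        (Continuous.continuousOn ?_)
      fun_prop

/-! ### Flags and signs -/

section

variable {r : ℕ} (B : Module.Basis (Fin r) ℝ (Vec r))

theorem mem_flag_iff (i : ℕ) (x : Vec r) :
    x ∈ flag B i ↔ ∀ ν : Fin r, i ≤ ν → B.coord ν x = 0 := by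
  rw [flag, B.mem_span_image]
  constructor
  · intro h ν hν
    by_contra hne
    have : (ν : ℕ) < i := h (Finsupp.mem_support_iff.2 hne)
    omega
  · intro h ν hν
    by_contra hlt
    exact Finsupp.mem_support_iff.1 hν (h ν (not_lt.1 hlt))

theorem basis_mem_flag {i : ℕ} {ν : Fin r} (h : (ν : ℕ) < i) : B ν ∈ flag B i :=
  Submodule.subset_span ⟨ν, h, rfl⟩

theorem flag_mono {i j : ℕ} (h : i ≤ j) : flag B i ≤ flag B j := fun x hx =>
  (mem_flag_iff B j x).2 fun ν hν => (mem_flag_iff B i x).1 hx ν (h.trans hν)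

theorem coord_eq_zero_of_mem_flag (i : Fin r) {x : Vec r} (hx : x ∈ flag B i) :
    B.coord i x = 0 :=
  (mem_flag_iff B i x).1 hx i le_rfl

theorem sub_coord_smul_mem_flag (i : Fin r) {x : Vec r} (hx : x ∈ flag B (i + 1)) :
    x - B.coord i x • B i ∈ flag B i := by
  rw [mem_flag_iff] at hx ⊢
  intro ν hν
  rcases eq_or_ne i ν with rfl | hne
  · simp
  · have : (i : ℕ) + 1 ≤ ν := by have := Fin.val_ne_iff.2 hne; omega
    have h2 := hx ν this
    simp only [Module.Basis.coord_apply] at h2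
    simp [hne, h2]

theorem mem_flag_succ_iff (i : Fin r) (x : Vec r) :
    x ∈ flag B (i + 1) ↔ ∃ s ∈ flag B i, ∃ t : ℝ, x = s + t • B i := by
  constructor
  · intro hx
    exact ⟨_, sub_coord_smul_mem_flag B i hx, B.coord i x, by simp⟩
  · rintro ⟨s, hs, t, rfl⟩
    exact Submodule.add_mem _ (flag_mono B (Nat.le_succ _) hs)
      (Submodule.smul_mem _ _ (basis_mem_flag B (Nat.lt_succ_self _)))

theorem flag_zero : flag B 0 = ⊥ := by
  rw [flag]
  simp

theorem flag_top : flag B r = ⊤ := by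
  rw [eq_top_iff]
  intro x _
  rw [mem_flag_iff]
  intro ν hν
  exact absurd ν.2 (not_lt.2 hν)

/-- The map fixing the earlier basis vectors and sending `B i` to `u` is a transvection with
determinant `B.coord i u`. It is the only candidate, because its values on a spanning set are
prescribed. -/
theorem isPositive_iff (i : Fin r) {u : Vec r} (hu : u ∈ flag B (i + 1)) :
    IsPositive B i u ↔ 0 < B.coord i u := by
  have hbi : B i ∈ flag B (i + 1) := basis_mem_flag B (Nat.lt_succ_self _)
  let g : flag B (i + 1) →ₗ[ℝ] flag B (i + 1) :=
    LinearMap.transvection ((B.coord i).domRestrict _) (⟨u, hu⟩ - ⟨B i, hbi⟩)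
  have hg (x : flag B (i + 1)) : (g x : Vec r) = x + B.coord i x • (u - B i) := by
    simp [g, LinearMap.transvection.apply]
  have hdet : LinearMap.det g = B.coord i u := by
    rw [LinearMap.transvection.det]
    simp
  have hgb : ∀ ν ≤ i, ∀ x : flag B (i + 1), (x : Vec r) = B ν →
      (g x : Vec r) = Function.update B i u ν := by
    intro ν hν x hx
    rw [hg, hx]
    rcases eq_or_ne ν i with rfl | hne
    · simp
    · simp [hne]
  refine ⟨?_, fun h => ⟨g, hgb, hdet ▸ h⟩⟩
  rintro ⟨f, hf, hpos⟩
  have : f = g := by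
    ext1 ⟨x, hx⟩
    refine Submodule.span_induction (p := fun x hx => f ⟨x, hx⟩ = g ⟨x, hx⟩) ?_ ?_ ?_ ?_ hx
    · rintro _ ⟨ν, hν, rfl⟩
      have hν' : ν ≤ i := Fin.le_def.2 (Nat.lt_succ_iff.1 hν)
      exact Subtype.ext ((hf ν hν' _ rfl).trans (hgb ν hν' _ rfl).symm)
    · exact (map_zero f).trans (map_zero g).symm
    · intro x y hx hy h1 h2
      have := congrArg₂ (· + ·) h1 h2
      simp only [← map_add] at this
      exact this
    · intro a x hx h
      have := congrArg (a • ·) h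
      simp only [← map_smul] at this
      exact this
  rwa [this, hdet] at hpos

variable {N : ℕ} (Z : Fin N → Vec r)

theorem mem_posPart_iff (i : Fin r) (k : Fin N) :
    k ∈ posPart Z B i ↔ Z k ∈ flag B (i + 1) ∧ 0 < B.coord i (Z k) := by
  simp only [posPart, Finset.mem_filter, Finset.mem_univ, true_and]
  constructor
  · rintro ⟨h1, -, h3⟩
    exact ⟨h1, (isPositive_iff B i h1).1 h3⟩
  · rintro ⟨h1, h2⟩
    exact ⟨h1, fun h => h2.ne' (coord_eq_zero_of_mem_flag B i h), (isPositive_iff B i h1).2 h2⟩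

theorem mem_negPart_iff (i : Fin r) (k : Fin N) :
    k ∈ negPart Z B i ↔ Z k ∈ flag B (i + 1) ∧ B.coord i (Z k) < 0 := by
  simp only [negPart, Finset.mem_filter, Finset.mem_univ, true_and]
  constructor
  · rintro ⟨h1, h2, h3⟩
    rw [isPositive_iff B i h1, not_lt] at h3
    refine ⟨h1, lt_of_le_of_ne h3 fun h0 => h2 ?_⟩
    simpa [h0] using sub_coord_smul_mem_flag B i h1
  · rintro ⟨h1, h2⟩
    refine ⟨h1, fun h => h2.ne (coord_eq_zero_of_mem_flag B i h), ?_⟩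
    rw [isPositive_iff B i h1]
    exact not_lt.2 h2.le

/-- The list `(P_i, -N_i)`. -/
noncomputable def layerList (i : Fin r) : posPart Z B i ⊕ negPart Z B i → Vec r :=
  Sum.elim (sub Z (posPart Z B i)) (-sub Z (negPart Z B i))

theorem layerList_mem_flag (i : Fin r) (k) : layerList B Z i k ∈ flag B (i + 1) := by
  rcases k with k | k
  · exact ((mem_posPart_iff B Z i k).1 k.2).1
  · exact Submodule.neg_mem _ ((mem_negPart_iff B Z i k).1 k.2).1

theorem coord_layerList_pos (i : Fin r) (k) : 0 < B.coord i (layerList B Z i k) := by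
  rcases k with k | k
  · exact ((mem_posPart_iff B Z i k).1 k.2).2
  · have := ((mem_negPart_iff B Z i k).1 k.2).2
    rw [layerList, Sum.elim_inr, Pi.neg_apply, map_neg, neg_pos]
    exact this

theorem layerList_sub_mem_flag (i : Fin r) (k) :
    layerList B Z i k - B.coord i (layerList B Z i k) • B i ∈ flag B i :=
  sub_coord_smul_mem_flag B i (layerList_mem_flag B Z i k)

theorem pointed_layerList (i : Fin r) : Pointed (layerList B Z i) :=
  ⟨B.coord i, coord_layerList_pos B Z i⟩

theorem card_layerList (i : Fin r) :
    Fintype.card (posPart Z B i ⊕ negPart Z B i) = (posPart Z B i).card + (negPart Z B i).card := by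
  simp

/-- A nonzero vector lies in exactly one layer, that of its last nonzero coordinate. -/
theorem sum_card_posPart_add_card_negPart (hZ : ∀ k, Z k ≠ 0) :
    ∑ i, ((posPart Z B i).card + (negPart Z B i).card) = N := by
  classical
  have hdisj (i) : Disjoint (posPart Z B i) (negPart Z B i) := Finset.disjoint_left.2 fun k h h' =>
    lt_asymm ((mem_posPart_iff B Z i k).1 h).2 ((mem_negPart_iff B Z i k).1 h').2
  simp only [← Finset.card_union_of_disjoint (hdisj _)]
  have hmem (i k) : k ∈ posPart Z B i ∪ negPart Z B i ↔
      Z k ∈ flag B (i + 1) ∧ B.coord i (Z k) ≠ 0 := by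
    rw [Finset.mem_union, mem_posPart_iff, mem_negPart_iff, ← and_or_left, ne_iff_lt_or_gt, or_comm]
  rw [← Finset.card_biUnion]
  · conv_rhs => rw [← Finset.card_fin N]
    congr 1
    ext k
    simp only [Finset.mem_biUnion, Finset.mem_univ, true_and, iff_true]
    have hex : (Finset.univ.filter fun ν => B.coord ν (Z k) ≠ 0).Nonempty := by
      by_contra hne
      rw [Finset.not_nonempty_iff_eq_empty, Finset.filter_eq_empty_iff] at hne
      refine hZ k (B.ext_elem fun ν => ?_)
      simpa using hne (Finset.mem_univ ν)
    obtain ⟨i, hi, hmax⟩ := Finset.exists_maximal hex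
    refine ⟨i, (hmem i k).2 ⟨(mem_flag_iff B _ _).2 fun ν hν => ?_, (Finset.mem_filter.1 hi).2⟩⟩
    by_contra hne
    have := hmax (Finset.mem_filter.2 ⟨Finset.mem_univ ν, hne⟩) (Fin.le_def.2 (by omega))
    rw [Fin.le_def] at this
    omega
  · intro i _ j _ hij
    refine Finset.disjoint_left.2 fun k h h' => ?_
    rw [hmem] at h h'
    rcases lt_or_gt_of_ne hij with hlt | hlt
    · exact h'.2 ((mem_flag_iff B _ _).1 h.1 j hlt)
    · exact h.2 ((mem_flag_iff B _ _).1 h'.1 i hlt)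

end

/-! ### The factors `T_i^{B±}` and `R_i^B` -/

section

variable {r N : ℕ} (B : Module.Basis (Fin r) ℝ (Vec r)) (Z : Fin N → Vec r)

/-- The sign `(-1)^{|N_i|}`. -/
noncomputable def layerSign (i : Fin r) : ℝ := (-1) ^ (negPart Z B i).card

theorem layerSign_mul_self (i : Fin r) : layerSign B Z i * layerSign B Z i = 1 := by
  rw [layerSign, ← pow_add, Even.neg_one_pow ⟨_, rfl⟩]

theorem layerSign_ne_zero (i : Fin r) : layerSign B Z i ≠ 0 := fun h => by
  simpa [h] using layerSign_mul_self B Z i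

theorem neg_layerList (i : Fin r) :
    -layerList B Z i = Sum.elim (-sub Z (posPart Z B i)) (sub Z (negPart Z B i)) := by
  ext1 k
  rcases k with k | k <;> simp [layerList]

theorem isConvolution_plus (i : Fin r) :
    IsConvolution (spline (sub Z (posPart Z B i))) (spline (-sub Z (negPart Z B i)))
      (spline (layerList B Z i)) :=
  isConvolution_spline (pointed_layerList B Z i)

theorem isConvolution_minus (i : Fin r) :
    IsConvolution (spline (-sub Z (posPart Z B i))) (spline (sub Z (negPart Z B i)))
      (spline (-layerList B Z i)) := by
  have h := (pointed_layerList B Z i).neg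
  rw [neg_layerList] at h ⊢
  exact isConvolution_spline h

theorem Tplus_eq (i : Fin r) : Tplus Z B i = layerSign B Z i • spline (layerList B Z i) := by
  rw [Tplus, (isConvolution_plus B Z i).conv_eq, layerSign]

/-- Once `(-1)^{|N_i|}` is factored out, the relative sign of the two opposite splines is the parity
of the whole layer, as in `integral_mul_integral_orthant_sub`. -/
theorem Rfactor_apply (i : Fin r) (φ : Test r) :
    Rfactor Z B i φ = layerSign B Z i * (spline (layerList B Z i) φ -
      (-1) ^ Fintype.card (posPart Z B i ⊕ negPart Z B i) * spline (-layerList B Z i) φ) := by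
  rw [Rfactor, Tplus_eq, Tminus, (isConvolution_minus B Z i).conv_eq]
  change layerSign B Z i * spline (layerList B Z i) φ -
    (-1) ^ (posPart Z B i).card * spline (-layerList B Z i) φ = _
  rw [card_layerList, mul_sub, ← mul_assoc, pow_add,
    mul_left_comm, ← layerSign, layerSign_mul_self, mul_one]

theorem contDiff_Rfactor_translate (i : Fin r) (φ : Test r) :
    ContDiff ℝ (⊤ : ℕ∞) fun ξ => Rfactor Z B i (translate ξ φ) := by
  simp only [Rfactor_apply]
  have h := pointed_layerList B Z i
  exact contDiff_const.mul ((contDiff_spline_translate h φ).sub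
    (contDiff_const.mul (contDiff_spline_translate h.neg φ)))

theorem Rfactor_translate (i : Fin r) (φ : Test r) (ξ : Vec r) :
    Rfactor Z B i (translate ξ φ) = layerSign B Z i *
      ((∫ w in Set.Ici (0 : posPart Z B i ⊕ negPart Z B i → ℝ),
        φ (ξ + ∑ k, w k • layerList B Z i k)) -
      (-1) ^ Fintype.card (posPart Z B i ⊕ negPart Z B i) *
        ∫ w in Set.Ici (0 : posPart Z B i ⊕ negPart Z B i → ℝ),
          φ (ξ + ∑ k, w k • (-layerList B Z i) k)) := by
  have h := pointed_layerList B Z i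
  rw [Rfactor_apply, spline_translate h, spline_translate h.neg]

/-- The two opposite cones share a double cone, described by the absolute value of the coordinate.
-/
theorem dsupport_Rfactor_subset (i : Fin r) {M : ℝ}
    (hM : ∀ k, ‖layerList B Z i k‖ ≤ M * B.coord i (layerList B Z i k)) :
    Distribution.dsupport (Rfactor Z B i) ⊆ {x | ‖x‖ ≤ M * |B.coord i x|} := by
  have hc : Continuous (B.coord i) := (B.coord i).continuous_of_finiteDimensional
  have h := pointed_layerList B Z i
  refine dsupport_subset (isClosed_le continuous_norm (continuous_const.mul hc.abs))
    fun φ hφ => ?_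
  rw [Rfactor_apply, spline_apply h, spline_apply h.neg,
    setIntegral_eq_zero_of_forall_eq_zero fun l hl => ?_,
    setIntegral_eq_zero_of_forall_eq_zero fun l hl => ?_]
  · simp
  all_goals
    have h1 := norm_sum_smul_le hM hl
    have h0 : 0 ≤ B.coord i (∑ k, l k • layerList B Z i k) := by
      simp only [map_sum, map_smul, smul_eq_mul]
      exact Finset.sum_nonneg fun k _ => mul_nonneg (hl k) (coord_layerList_pos B Z i k).le
    rw [← abs_of_nonneg h0] at h1
  · rw [sum_smul_neg]
    refine hφ _ ?_
    simpa only [Set.mem_ofPred_eq, norm_neg, map_neg, abs_neg] using h1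
  · exact hφ _ h1

/-- If `k - y` lies in the flag, then `y` has the same `i`-th coordinate as `k ∈ K`, and the double
cone turns this into a bound on `y`. So convolving with a two-sided factor is legitimate. -/
theorem isBounded_flag_inter_sub (i : Fin r) {M : ℝ} {K : Set (Vec r)}
    (hK : IsCompact K) :
    Bornology.IsBounded ((flag B i : Set (Vec r)) ∩ (K - {x | ‖x‖ ≤ M * |B.coord i x|})) := by
  have hc : Continuous (B.coord i) := (B.coord i).continuous_of_finiteDimensional
  obtain ⟨a, ha⟩ := (hK.image (hc.abs.const_smul M)).bddAbove
  obtain ⟨R, hR⟩ := hK.isBounded.subset_closedBall 0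
  refine (Metric.isBounded_closedBall (x := (0 : Vec r)) (r := R + a)).subset ?_
  rintro _ ⟨hx, k, hk, y, hy, rfl⟩
  have h1 : ‖k‖ ≤ R := by simpa using hR hk
  have h2 : M * |B.coord i k| ≤ a := ha ⟨k, hk, rfl⟩
  have h3 : B.coord i k = B.coord i y := by
    rw [← sub_eq_zero, ← map_sub]
    exact coord_eq_zero_of_mem_flag B i hx
  rw [h3] at h2
  rw [mem_closedBall_zero_iff]
  exact (norm_sub_le k y).trans (add_le_add h1 (le_trans hy h2))

theorem IsLayer.distrOfDensity_apply {S : Submodule ℝ (Vec r)} {μ : Measure (Vec r)}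
    (hμ : IsLayer S μ) (p : MvPolynomial (Fin r) ℝ) (φ : Test r) :
    distrOfDensity μ (fun x => MvPolynomial.eval x p) φ =
      ∫ x, φ x * MvPolynomial.eval x p ∂μ := by
  have := hμ.isFiniteMeasureOnCompacts
  exact ZonotopalSpline.distrOfDensity_apply
    (MvPolynomial.continuous_eval p).locallyIntegrable φ

/-- The convolution of a polynomial density on `S_i` with `R_{i+1}^B` is a polynomial density on
`S_{i+1}`. -/
theorem IsLayer.isConvolution_Rfactor {i : Fin r} {μ : Measure (Vec r)}
    (hμ : IsLayer (flag B i) μ) [Nonempty (posPart Z B i ⊕ negPart Z B i)]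
    {κ : Measure (posPart Z B i ⊕ negPart Z B i → ℝ)}
    (hκ : IsSimplexMeasure (fun k => B.coord i (layerList B Z i k)) κ)
    {p q : MvPolynomial (Fin r) ℝ} (hq : ∀ z, MvPolynomial.eval z q =
      layerSign B Z i * slice (B.coord i) (layerList B Z i) κ (fun x => MvPolynomial.eval x p) z) :
    IsConvolution (distrOfDensity μ fun x => MvPolynomial.eval x p) (Rfactor Z B i)
      (distrOfDensity (extend μ (B i)) fun x => MvPolynomial.eval x q) := by
  obtain ⟨M, -, hM⟩ := exists_norm_le_mul (coord_layerList_pos B Z i)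
  refine isConvolution_of_forall (A := flag B i) (dsupport_subset
    (flag B i).closed_of_finiteDimensional fun φ hφ => ?_) (dsupport_Rfactor_subset B Z i hM)
    (fun K hK => isBounded_flag_inter_sub B i hK) (contDiff_Rfactor_translate B Z i)
    fun φ ψ hψ => ?_
  · rw [hμ.distrOfDensity_apply]
    refine integral_eq_zero_of_ae ?_
    filter_upwards [hμ.ae_mem] with x hx
    simp [hφ x hx]
  · have hμ' : IsLayer (flag B (i + 1)) (extend μ (B i)) :=
      isLayer_extend hμ (l := B.coord i) (by simp)
        (fun s hs => coord_eq_zero_of_mem_flag B i hs) (mem_flag_succ_iff B i)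
    rw [hμ.distrOfDensity_apply, hμ'.distrOfDensity_apply]
    have h := hμ.integral_mul_integral_orthant_sub (l := B.coord i) (b := B i) (by simp)
      (fun s hs => coord_eq_zero_of_mem_flag B i hs) (layerList_sub_mem_flag B Z i)
      (coord_layerList_pos B Z i) hκ (MvPolynomial.continuous_eval p) φ.continuous
      φ.hasCompactSupport
    have h1 : ∫ x, ψ x * MvPolynomial.eval x p ∂μ =
        ∫ x, Rfactor Z B i (translate x φ) * MvPolynomial.eval x p ∂μ := by
      refine integral_congr_ae ?_
      filter_upwards [hμ.ae_mem] with x hx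
      rw [hψ x hx]
    rw [h1]
    simp only [Rfactor_translate, hq]
    have h2 := congrArg (layerSign B Z i * ·) h
    rw [← integral_const_mul (layerSign B Z i), ← integral_const_mul (layerSign B Z i)] at h2
    refine Eq.trans ?_ (h2.symm.trans ?_)
    · congr 1
      ext x
      ring
    · congr 1
      ext x
      ring

/-! ### Narrow cones -/

/-- The vectors whose first `i` coordinates are positive and decrease fast. -/
def narrowCone (i : ℕ) (ε : ℝ) : Set (Vec r) :=
  {z | (∀ ν : Fin r, (ν : ℕ) < i → 0 < B.coord ν z) ∧
    ∀ ν ν' : Fin r, ν < ν' → (ν' : ℕ) < i → B.coord ν' z < ε * B.coord ν z}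

/-- All coordinates of `v` are controlled by the `i`-th coordinate of `z`, which in a sufficiently
narrow cone is small against the earlier ones. Subtracting `v` thus hardly affects their ratios. -/
theorem exists_narrowCone_sub (i : Fin r) {ε M : ℝ} (hε : 0 < ε) (hM : 0 ≤ M) :
    ∃ ε' : ℝ, 0 < ε' ∧ ∀ z ∈ narrowCone B (i + 1) ε', ∀ v : Vec r,
      (∀ ν, |B.coord ν v| ≤ M * B.coord i z) → z - v ∈ narrowCone B i ε := by
  have hD : 0 < 1 + M + ε * M := by positivity
  -- This `ε'` solves `ε' * (1 + M) = ε * (1 - ε' * M)`. After the subtraction, coordinate `ν` keeps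
  -- at least the share `1 - ε' * M`, and a later one stays below `ε' * (1 + M)` times the old
  -- coordinate `ν`.
  refine ⟨ε / (1 + M + ε * M), by positivity, fun z hz v hv => ?_⟩
  obtain ⟨h1, h2⟩ := hz
  set ε' := ε / (1 + M + ε * M) with hε'
  have hε'0 : 0 < ε' := by positivity
  have hmul : ε' * (1 + M + ε * M) = ε := div_mul_cancel₀ _ hD.ne'
  have hM1 : 0 < 1 - ε' * M := by
    have : ε * (1 - ε' * M) = ε' * (1 + M) := by linear_combination -hmul
    have h3 : 0 < ε * (1 - ε' * M) := by rw [this]; positivity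
    exact pos_of_mul_pos_right h3 hε.le
  have hlow (ν : Fin r) (hν : (ν : ℕ) < i) :
      (1 - ε' * M) * B.coord ν z ≤ B.coord ν (z - v) ∧ |B.coord ν v| ≤ M * (ε' * B.coord ν z) := by
    have h3 := h2 ν i hν (Nat.lt_succ_self _)
    have h4 := (hv ν).trans (mul_le_mul_of_nonneg_left h3.le hM)
    refine ⟨?_, h4⟩
    rw [map_sub]
    linarith [le_abs_self (B.coord ν v)]
  refine ⟨fun ν hν => ?_, fun ν ν' hlt hν' => ?_⟩
  · exact (mul_pos hM1 (h1 ν (hν.trans (Nat.lt_succ_self _)))).trans_le (hlow ν hν).1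
  · have hν : (ν : ℕ) < i := lt_trans hlt hν'
    have h3 := h2 ν ν' hlt (hν'.trans (Nat.lt_succ_self _))
    have h4 : |B.coord ν' v| ≤ M * (ε' * B.coord ν z) :=
      (hv ν').trans (mul_le_mul_of_nonneg_left (h2 ν i hν (Nat.lt_succ_self _)).le hM)
    have h5 := mul_le_mul_of_nonneg_left (hlow ν hν).1 hε.le
    have h6 : B.coord ν' (z - v) < ε' * B.coord ν z + M * (ε' * B.coord ν z) := by
      rw [map_sub]
      linarith [neg_abs_le (B.coord ν' v)]
    have h7 : ε * ((1 - ε' * M) * B.coord ν z) = ε' * B.coord ν z + M * (ε' * B.coord ν z) := by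
      linear_combination (-B.coord ν z) * hmul
    linarith

theorem exists_abs_coord_le (i : Fin r) :
    ∃ M : ℝ, 0 ≤ M ∧ ∀ w : posPart Z B i ⊕ negPart Z B i → ℝ, w ∈ Set.Ici 0 → ∀ ν,
      |B.coord ν (∑ k, w k • layerList B Z i k)| ≤
        M * B.coord i (∑ k, w k • layerList B Z i k) := by
  obtain ⟨M, hM0, hM⟩ := exists_norm_le_mul (coord_layerList_pos B Z i)
  let C : ℝ := ∑ ν, ‖LinearMap.toContinuousLinearMap (B.coord ν)‖
  have hC0 : 0 ≤ C := Finset.sum_nonneg fun _ _ => norm_nonneg _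
  refine ⟨C * M, by positivity, fun w hw ν => ?_⟩
  have h1 := norm_sum_smul_le hM hw
  have h2 := (LinearMap.toContinuousLinearMap (B.coord ν)).le_opNorm
    (∑ k, w k • layerList B Z i k)
  have h3 : ‖LinearMap.toContinuousLinearMap (B.coord ν)‖ ≤ C :=
    Finset.single_le_sum (f := fun ν => ‖LinearMap.toContinuousLinearMap (B.coord ν)‖)
      (fun _ _ => norm_nonneg _) (Finset.mem_univ ν)
  rw [mul_assoc]
  exact h2.trans (mul_le_mul h3 h1 (norm_nonneg _) hC0)

/-! ### The local piece -/

/-- The coordinate `B.coord i` vanishes on `X` and is positive on the new layer. A large multiple of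
it, added to a functional positive on `X`, makes the sum positive on both. -/
theorem exists_pointed_sumElim {i : Fin r} {ι : Type*} [Finite ι] {X : ι → Vec r}
    (hX : Pointed X) (hXi : ∀ k, X k ∈ flag B i) : Pointed (Sum.elim X (layerList B Z i)) := by
  obtain ⟨f, hf⟩ := hX
  obtain ⟨M, hM0, hM⟩ := exists_norm_le_mul (coord_layerList_pos B Z i)
  let C : ℝ := ‖LinearMap.toContinuousLinearMap f‖
  refine ⟨f + (C * M + 1) • B.coord i, ?_⟩
  rintro (k | k)
  · have := coord_eq_zero_of_mem_flag B i (hXi k)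
    simp only [Sum.elim_inl, LinearMap.add_apply, LinearMap.smul_apply, this, smul_zero, add_zero]
    exact hf k
  · simp only [Sum.elim_inr, LinearMap.add_apply, LinearMap.smul_apply, smul_eq_mul]
    have h1 := (LinearMap.toContinuousLinearMap f).le_opNorm (layerList B Z i k)
    have h2 : |f (layerList B Z i k)| ≤ C * (M * B.coord i (layerList B Z i k)) :=
      h1.trans (mul_le_mul_of_nonneg_left (hM k) (norm_nonneg _))
    have h3 := coord_layerList_pos B Z i k
    linarith [neg_abs_le (f (layerList B Z i k))]

/-- The spline with coefficient `c` agrees near the narrow cone with the density `p`. -/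
def AgreesOnNarrowCone (i : ℕ) (ε : ℝ) {ι : Type*} [Fintype ι] (X : ι → Vec r) (c : ℝ)
    (μ : Measure (Vec r)) (p : Vec r → ℝ) : Prop :=
  ∀ φ : Vec r → ℝ, Continuous φ → HasCompactSupport φ →
    (∀ z ∈ flag B i, φ z ≠ 0 → z ∈ narrowCone B i ε) →
    c * ∫ l in Set.Ici (0 : ι → ℝ), φ (∑ k, l k • X k) = ∫ z, p z * φ z ∂μ

/-- For fixed coefficients `w` of the new layer, the translate of `φ`, seen on the flag, is
supported in the cone one level lower, so the hypothesis replaces the spline by `p`. Integrating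
over `w` yields the slice on a half-space, outside of which `φ` vanishes on the new flag. -/
theorem AgreesOnNarrowCone.succ {i : Fin r} {ε ε' M : ℝ}
    (hM : ∀ w : posPart Z B i ⊕ negPart Z B i → ℝ, w ∈ Set.Ici 0 → ∀ ν,
      |B.coord ν (∑ k, w k • layerList B Z i k)| ≤
        M * B.coord i (∑ k, w k • layerList B Z i k))
    (hε' : ∀ z ∈ narrowCone B (i + 1) ε', ∀ v : Vec r,
      (∀ ν, |B.coord ν v| ≤ M * B.coord i z) → z - v ∈ narrowCone B i ε)
    {ι : Type*} [Fintype ι] {X : ι → Vec r} (hX : Pointed X) (hXi : ∀ k, X k ∈ flag B i) {c : ℝ}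
    {μ : Measure (Vec r)} (hμ : IsLayer (flag B i) μ) {p : Vec r → ℝ} (hp : Continuous p)
    {κ : Measure (posPart Z B i ⊕ negPart Z B i → ℝ)}
    (hκ : IsSimplexMeasure (fun k => B.coord i (layerList B Z i k)) κ)
    (h : AgreesOnNarrowCone B i ε X c μ p) :
    AgreesOnNarrowCone B (i + 1) ε' (Sum.elim X (layerList B Z i)) (c * layerSign B Z i)
      (extend μ (B i))
      (fun z => layerSign B Z i * slice (B.coord i) (layerList B Z i) κ p z) := by
  intro φ hφ hφc hφn
  have := hμ.sigmaFinite
  have hμ' : IsLayer (flag B (i + 1)) (extend μ (B i)) :=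
    isLayer_extend hμ (l := B.coord i) (by simp)
      (fun s hs => coord_eq_zero_of_mem_flag B i hs) (mem_flag_succ_iff B i)
  have hS : ∀ s ∈ flag B i, B.coord i s = 0 := fun s hs => coord_eq_zero_of_mem_flag B i hs
  have hpos := coord_layerList_pos B Z i
  have h1 : ∀ w ∈ Set.Ici (0 : posPart Z B i ⊕ negPart Z B i → ℝ),
      c * ∫ x in Set.Ici (0 : ι → ℝ), φ (∑ k, x k • X k + ∑ k, w k • layerList B Z i k) =
        ∫ z, p z * φ (z + ∑ k, w k • layerList B Z i k) ∂μ := by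
    intro w hw
    refine h (fun z => φ (z + ∑ k, w k • layerList B Z i k)) (by fun_prop)
      (hφc.comp_homeomorph (Homeomorph.addRight _)) fun z hz hne => ?_
    set v := ∑ k, w k • layerList B Z i k with hv
    have hvm : v ∈ flag B (i + 1) :=
      Submodule.sum_mem _ fun k _ => Submodule.smul_mem _ _ (layerList_mem_flag B Z i k)
    have hzv := hφn (z + v) (Submodule.add_mem _ (flag_mono B (Nat.le_succ _) hz) hvm) hne
    have := hε' _ hzv v fun ν => by
      rw [map_add, hS z hz, zero_add]
      exact hM w hw ν
    simpa using this
  have h2 := hμ.integral_mul_integral_orthant (l := B.coord i) (b := B i) (by simp) hS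
    (layerList_sub_mem_flag B Z i) hpos hκ hp hφ hφc
  have hint := hμ.integrable_mul_comp_add_sum hS hpos hp hφ hφc
  rw [setIntegral_orthant_sumElim_symm (exists_pointed_sumElim B Z hX hXi) hφ hφc,
    mul_comm c, mul_assoc, ← integral_const_mul, setIntegral_congr_fun measurableSet_Ici h1]
  simp only [mul_assoc, integral_const_mul]
  congr 1
  rw [← integral_integral_swap
    (f := fun (z : Vec r) (w : posPart Z B i ⊕ negPart Z B i → ℝ) =>
      p z * φ (z + ∑ k, w k • layerList B Z i k)) hint]
  simp only [integral_const_mul]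
  rw [h2]
  refine setIntegral_eq_integral_of_ae_compl_eq_zero ?_
  filter_upwards [hμ'.ae_mem] with z hz hneg
  by_contra hne
  exact hneg ((hφn z hz (right_ne_zero_of_mul hne)).1 i (Nat.lt_succ_self _))

/-- For `κ = 0` the polar formula would give the unit cube volume zero. -/
theorem IsSimplexMeasure.measure_univ_pos {ι : Type*} [Fintype ι] {h : ι → ℝ}
    {κ : Measure (ι → ℝ)} (hκ : IsSimplexMeasure h κ) : 0 < κ Set.univ := by
  rw [pos_iff_ne_zero, Ne, Measure.measure_univ_eq_zero]
  rintro rfl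
  have hm : MeasurableSet (Set.Icc (0 : ι → ℝ) 1) := measurableSet_Icc
  have h1 := hκ.integral_eq (Set.indicator (Set.Icc 0 1) fun _ => 1)
    (stronglyMeasurable_const.indicator hm)
    (((integrable_indicator_iff hm).2 (integrableOn_const
      (isCompact_Icc.measure_lt_top.ne))).integrableOn)
  rw [setIntegral_indicator hm, Set.inter_eq_right.2 Set.Icc_subset_Ici_self] at h1
  simp [Real.volume_Icc_pi, Measure.real] at h1

theorem slice_pos {ι : Type*} [Fintype ι] {l : Vec r →ₗ[ℝ] ℝ} {Y : ι → Vec r}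
    (hpos : ∀ k, 0 < l (Y k)) {κ : Measure (ι → ℝ)} (hκ : IsSimplexMeasure (fun k => l (Y k)) κ)
    {p : Vec r → ℝ} (hp : Continuous p) {z : Vec r} (hz : 0 < l z)
    (h : ∀ ω ∈ simplex (fun k => l (Y k)), 0 < p (z - l z • ∑ k, ω k • Y k)) :
    0 < slice l Y κ p z := by
  have := hκ.isFiniteMeasure
  have hΔ := isCompact_simplex hpos
  have hc : Continuous fun ω : ι → ℝ => p (z - l z • ∑ k, ω k • Y k) := by fun_prop
  refine mul_pos (pow_pos hz _) ?_
  rw [setIntegral_pos_iff_support_of_nonneg_ae]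
  · have h0 : κ (simplex fun k => l (Y k)) = κ Set.univ :=
      measure_congr (Filter.eventuallyEq_univ.2 hκ.ae_mem)
    refine (h0 ▸ hκ.measure_univ_pos).trans_le (measure_mono fun ω hω => ⟨(h ω hω).ne', hω⟩)
  · filter_upwards [ae_restrict_mem hΔ.measurableSet] with ω hω
    exact (h ω hω).le
  · exact hc.continuousOn.integrableOn_compact hΔ

end

/-! ### The main induction -/

section

variable {r N : ℕ} (B : Module.Basis (Fin r) ℝ (Vec r)) (Z : Fin N → Vec r)

/-- The first `i` factors of `R_1^B * ⋯ * R_r^B` convolve to a polynomial density `p` on `S_i`,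
which is the local piece of the convolution of the first `i` factors of
`T_1^{B+} * ⋯ * T_r^{B+}`. -/
structure IsPartialPiece (i : ℕ) (hi : i ≤ r) (μ : Measure (Vec r)) (p : MvPolynomial (Fin r) ℝ)
    (d : ℕ) : Prop where
  isLayer : IsLayer (flag B i) μ
  ne_zero : μ ≠ 0
  isHomogeneous : p.IsHomogeneous d
  degree_add : d + i = ∑ ν : Fin i,
    ((posPart Z B (ν.castLE hi)).card + (negPart Z B (ν.castLE hi)).card)
  iterConvolvable_R : IterConvolvable i fun ν => Rfactor Z B (ν.castLE hi)
  iterConv_R : iterConv i (fun ν => Rfactor Z B (ν.castLE hi)) =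
    distrOfDensity μ fun x => MvPolynomial.eval x p
  iterConvolvable_T : IterConvolvable i fun ν => Tplus Z B (ν.castLE hi)
  exists_spline : ∃ (ι : Type) (_ : Fintype ι) (X : ι → Vec r) (c ε : ℝ), Pointed X ∧
    (∀ k, X k ∈ flag B i) ∧ c ≠ 0 ∧ 0 < ε ∧
    iterConv i (fun ν => Tplus Z B (ν.castLE hi)) = c • spline X ∧
    AgreesOnNarrowCone B i ε X c μ (fun x => MvPolynomial.eval x p) ∧
    ∀ z ∈ flag B i, z ∈ narrowCone B i ε → 0 < c * MvPolynomial.eval z p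

/-- The unit `δ_0` is both the density one against the Dirac measure and the spline of the empty
list. -/
theorem isPartialPiece_zero : IsPartialPiece B Z 0 (Nat.zero_le r) (Measure.dirac 0) 1 0 where
  isLayer := by rw [flag_zero]; exact isLayer_bot
  ne_zero := NeZero.ne _
  isHomogeneous := MvPolynomial.isHomogeneous_one _ _
  degree_add := by simp
  iterConvolvable_R := trivial
  iterConv_R := by
    have hL : IsLayer (⊥ : Submodule ℝ (Vec r)) (Measure.dirac 0) := isLayer_bot
    refine DFunLike.ext _ _ fun φ => ?_
    rw [hL.distrOfDensity_apply]
    simp [iterConv]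
  iterConvolvable_T := trivial
  exists_spline := by
    have hP : Pointed (Empty.elim : Empty → Vec r) := ⟨0, fun k => k.elim⟩
    have hI : ∀ φ : Vec r → ℝ,
        ∫ l in Set.Ici (0 : Empty → ℝ), φ (∑ k, l k • Empty.elim k) = φ 0 := by
      intro φ
      have : Set.Ici (0 : Empty → ℝ) = Set.univ := by
        ext x
        simp [Subsingleton.elim x 0]
      simp [this, Measure.real, volume_pi, Measure.pi_empty_univ]
    refine ⟨Empty, inferInstance, Empty.elim, 1, 1, hP, fun k => k.elim, one_ne_zero, one_pos,
      ?_, ?_, ?_⟩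
    · refine DFunLike.ext _ _ fun φ => ?_
      change φ 0 = 1 * spline Empty.elim φ
      rw [spline_apply hP, hI, one_mul]
    · intro φ hφ hφc _
      rw [hI]
      simp
    · simp

theorem exists_isPartialPiece_succ (hne : ∀ i, Nonempty (posPart Z B i)) {i : ℕ} (hi : i + 1 ≤ r)
    {μ : Measure (Vec r)} {p : MvPolynomial (Fin r) ℝ} {d : ℕ}
    (h : IsPartialPiece B Z i (Nat.le_of_succ_le hi) μ p d) :
    ∃ μ' p' d', IsPartialPiece B Z (i + 1) hi μ' p' d' := by
  let j : Fin r := ⟨i, hi⟩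
  have hμ : IsLayer (flag B j) μ := h.isLayer
  have := hμ.sigmaFinite
  have := hne j
  have hpos := coord_layerList_pos B Z j
  obtain ⟨κ, hκ⟩ := exists_isSimplexMeasure hpos
  have := hκ.isFiniteMeasure
  obtain ⟨q, hqh, hq⟩ := exists_eval_eq_slice hpos κ h.isHomogeneous
  have hpc : Continuous fun x => MvPolynomial.eval x p := MvPolynomial.continuous_eval p
  let p' : MvPolynomial (Fin r) ℝ := MvPolynomial.C (layerSign B Z j) * q
  have hp' (z : Vec r) : MvPolynomial.eval z p' = layerSign B Z j *
      slice (B.coord j) (layerList B Z j) κ (fun x => MvPolynomial.eval x p) z := by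
    simp [p', hq]
  have hR := hμ.isConvolution_Rfactor B Z hκ hp'
  obtain ⟨ι, _, X, c, ε, hX, hXi, hc, hε, hT, hagree, hsign⟩ := h.exists_spline
  have hXY := exists_pointed_sumElim B Z (i := j) hX hXi
  have hTc : IsConvolution (iterConv i fun ν => Tplus Z B (ν.castLE (Nat.le_of_succ_le hi)))
      (Tplus Z B j) ((c * layerSign B Z j) • spline (Sum.elim X (layerList B Z j))) := by
    rw [hT, Tplus_eq]
    exact (isConvolution_spline hXY).smul hc (layerSign_ne_zero B Z j)
  obtain ⟨M, hM0, hM⟩ := exists_abs_coord_le B Z j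
  obtain ⟨ε', hε', hcone⟩ := exists_narrowCone_sub B j hε hM0
  refine ⟨extend μ (B j), p', Fintype.card (posPart Z B j ⊕ negPart Z B j) - 1 + d, ?_⟩
  refine ⟨?_, ?_, ?_, ?_, ?_, ?_, ?_, ?_⟩
  · exact isLayer_extend hμ (l := B.coord j) (by simp)
      (fun s hs => coord_eq_zero_of_mem_flag B j hs) (mem_flag_succ_iff B j)
  · intro h0
    rw [extend, Measure.map_eq_zero_iff (measurable_add_smul _).aemeasurable,
      ← Measure.measure_univ_eq_zero, ← Set.univ_prod_univ, Measure.prod_prod] at h0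
    simp [h.ne_zero] at h0
  · simpa using (MvPolynomial.isHomogeneous_C _ _).mul hqh
  -- The truncated subtraction in the new degree is exact because the layer is nonempty.
  · rw [Fin.sum_univ_castSucc]
    have h1 := h.degree_add
    have h2 : 0 < Fintype.card (posPart Z B j ⊕ negPart Z B j) := Fintype.card_pos
    have h3 := card_layerList B Z j
    change _ = (∑ ν : Fin i, ((posPart Z B (ν.castLE (Nat.le_of_succ_le hi))).card +
      (negPart Z B (ν.castLE (Nat.le_of_succ_le hi))).card)) +
      ((posPart Z B j).card + (negPart Z B j).card)
    omega
  · have := h.iterConv_R ▸ hR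
    exact ⟨h.iterConvolvable_R, _, this⟩
  · have := h.iterConv_R ▸ hR.conv_eq
    exact this
  · exact ⟨h.iterConvolvable_T, _, hTc⟩
  · refine ⟨ι ⊕ (posPart Z B j ⊕ negPart Z B j), inferInstance, _, c * layerSign B Z j, ε', hXY,
      ?_, mul_ne_zero hc (layerSign_ne_zero B Z j), hε', hTc.conv_eq, ?_, fun z hz hzn => ?_⟩
    · rintro (k | k)
      · exact flag_mono B (Nat.le_succ i) (hXi k)
      · exact layerList_mem_flag B Z j k
    · simp only [hp']
      exact hagree.succ B Z hM hcone hX hXi hμ hpc hκ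
    -- The layer sign enters both the coefficient and the polynomial and squares to one, which
    -- leaves the slice of the positive function `c * p`.
    · rw [hp', mul_assoc, ← mul_assoc (layerSign B Z j), layerSign_mul_self, one_mul]
      have hzj : 0 < B.coord j z := hzn.1 j (Nat.lt_succ_self i)
      have key := slice_pos hpos hκ (continuous_const.mul hpc)
        (p := fun x => c * MvPolynomial.eval x p) hzj
        fun ω hω => ?_
      · rw [slice] at key ⊢
        rw [integral_const_mul] at key
        linarith
      · have h1 : B.coord j (∑ k, ω k • layerList B Z j k) = 1 := by
          simpa only [map_sum, map_smul, smul_eq_mul] using hω.2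
        -- Since `v` and `z` share the `j`-th coordinate, `z - v` lies in the smaller flag, where
        -- the positivity hypothesis is available.
        set v := B.coord j z • ∑ k, ω k • layerList B Z j k with hv
        have hvj : B.coord j v = B.coord j z := by rw [hv, map_smul, h1, smul_eq_mul, mul_one]
        refine hsign _ ?_ (hcone z hzn v fun ν => ?_)
        · have hvm : v ∈ flag B (j + 1) := Submodule.smul_mem _ _
            (Submodule.sum_mem _ fun k _ => Submodule.smul_mem _ _ (layerList_mem_flag B Z j k))
          have := sub_coord_smul_mem_flag B j (Submodule.sub_mem _ hz hvm)
          simpa only [map_sub, hvj, sub_self, zero_smul, sub_zero] using this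
        · have h2 := hM ω hω.1 ν
          rw [h1, mul_one] at h2
          rw [hv, map_smul, smul_eq_mul, abs_mul, abs_of_pos hzj, mul_comm]
          exact mul_le_mul_of_nonneg_right h2 hzj.le

theorem exists_isPartialPiece (hne : ∀ i, Nonempty (posPart Z B i)) (i : ℕ) (hi : i ≤ r) :
    ∃ μ p d, IsPartialPiece B Z i hi μ p d := by
  induction i with
  | zero => exact ⟨_, _, _, isPartialPiece_zero B Z⟩
  | succ i ih =>
    obtain ⟨μ, p, d, h⟩ := ih (Nat.le_of_succ_le hi)
    exact exists_isPartialPiece_succ B Z hne hi h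

/-! ### The cone around `τ` -/

/-- The narrow cone as a convex cone. -/
noncomputable def narrowConvexCone (ε : ℝ) : ConvexCone ℝ (Vec r) where
  carrier := narrowCone B r ε
  smul_mem' := by
    rintro c hc z ⟨h1, h2⟩
    refine ⟨fun ν hν => ?_, fun ν ν' hlt hν' => ?_⟩
    · rw [map_smul]
      exact mul_pos hc (h1 ν hν)
    · simp only [map_smul, smul_eq_mul]
      have := mul_lt_mul_of_pos_left (h2 ν ν' hlt hν') hc
      linarith
  add_mem' := by
    rintro z ⟨h1, h2⟩ z' ⟨h1', h2'⟩
    refine ⟨fun ν hν => ?_, fun ν ν' hlt hν' => ?_⟩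
    · rw [map_add]
      exact add_pos (h1 ν hν) (h1' ν hν)
    · simp only [map_add]
      linarith [h2 ν ν' hlt hν', h2' ν ν' hlt hν']

theorem isOpen_narrowCone (i : ℕ) (ε : ℝ) : IsOpen (narrowCone B i ε) := by
  have hc (ν : Fin r) : Continuous (B.coord ν) := (B.coord ν).continuous_of_finiteDimensional
  simp only [narrowCone, Set.ofPred_and, Set.ofPred_forall]
  refine IsOpen.inter ?_ ?_
  · exact isOpen_iInter_of_finite fun ν => isOpen_iInter_of_finite fun _ =>
      isOpen_lt continuous_const (hc ν)
  · exact isOpen_iInter_of_finite fun ν => isOpen_iInter_of_finite fun ν' =>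
      isOpen_iInter_of_finite fun _ => isOpen_iInter_of_finite fun _ =>
        isOpen_lt (hc ν') (continuous_const.mul (hc ν))

theorem coord_tau (c : ℝ) (ν : Fin r) : B.coord ν (tau B c) = 1 / c ^ (ν : ℕ) := by
  simp [tau, Finsupp.single_apply]

theorem tau_mem_narrowCone {ε : ℝ} (hε : 0 < ε) :
    ∃ c₀ : ℝ, 0 < c₀ ∧ ∀ c ≥ c₀, tau B c ∈ narrowCone B r ε := by
  -- The bound `c ≥ 1` makes the powers monotone, and `c > 1 / ε` makes the ratio `1 / c` of
  -- consecutive coordinates less than `ε`.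
  refine ⟨1 + 1 / ε, by positivity, fun c hc => ?_⟩
  have h1 : 1 ≤ c := by
    have : 0 < 1 / ε := by positivity
    linarith
  have h0 : 0 < c := by linarith
  refine ⟨fun ν _ => ?_, fun ν ν' hlt _ => ?_⟩
  · rw [coord_tau]
    positivity
  · rw [coord_tau, coord_tau]
    have h2 : c ^ ((ν : ℕ) + 1) ≤ c ^ (ν' : ℕ) := pow_le_pow_right₀ h1 hlt
    have h3 : 1 < ε * c := by
      have : 1 / ε < c := by linarith
      rwa [div_lt_iff₀' hε] at this
    have h4 : 0 < c ^ (ν : ℕ) := by positivity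
    calc 1 / c ^ (ν' : ℕ) ≤ 1 / c ^ ((ν : ℕ) + 1) := one_div_le_one_div_of_le (by positivity) h2
      _ < ε * (1 / c ^ (ν : ℕ)) := by
        rw [pow_succ, mul_one_div, div_lt_div_iff₀ (by positivity) h4]
        nlinarith

/-- Basis vectors are never reoriented, since their only nonzero coordinate is one. The positive
coordinates of `z` therefore express it in the cone, with the coefficients placed at the positions
`e i`. -/
theorem narrowCone_subset_listCone {e : Fin r → Fin N}
    (hB : ∀ i, B i = Z (e i)) (ε : ℝ) : narrowCone B r ε ⊆ listCone (reorient Z B) := by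
  classical
  rintro z ⟨h1, -⟩
  have hre (i : Fin r) : reorient Z B (e i) = B i := by
    rw [reorient, if_neg, hB]
    rintro ⟨j, hj⟩
    rw [mem_negPart_iff, ← hB] at hj
    have := hj.2
    simp only [Module.Basis.coord_apply, Module.Basis.repr_self, Finsupp.single_apply] at this
    split_ifs at this <;> linarith
  refine ⟨fun k => ∑ i, if e i = k then B.coord i z else 0, fun k => ?_, ?_⟩
  · refine Finset.sum_nonneg fun i _ => ?_
    split_ifs
    · exact (h1 i i.2).le
    · exact le_rfl
  · simp only [Finset.sum_smul, ite_smul, zero_smul]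
    rw [Finset.sum_comm]
    simp [hre, B.sum_repr]

end

/-! ### Comparison with Lebesgue measure and conclusion -/

theorem isAddLeftInvariant_of_isLayer_top {r : ℕ} {μ : Measure (Vec r)}
    (hμ : IsLayer (⊤ : Submodule ℝ (Vec r)) μ) : μ.IsAddLeftInvariant :=
  ⟨fun s => (hμ.measurePreserving s trivial).map_eq⟩

end ZonotopalSpline

theorem proposition3p1 {r N : ℕ} (Z : Fin N → ZonotopalSpline.Vec r)
    (e : Fin r → Fin N) (he : StrictMono e) (hb : LinearIndependent ℝ (Z ∘ e)) :
    ZonotopalSpline.WellDefined Z (Z ∘ e) ∧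
    ∃ p : MvPolynomial (Fin r) ℝ,
      ZonotopalSpline.RB Z (Z ∘ e) = ZonotopalSpline.polyDistr p ∧
      p ≠ 0 ∧
      ZonotopalSpline.IsLocalPieceNearTau Z (Z ∘ e) p ∧
      ((∀ k, Z k ≠ 0) → p.IsHomogeneous (N - r)) := by
  open ZonotopalSpline in
  obtain ⟨B, hB⟩ : ∃ B : Module.Basis (Fin r) ℝ (Vec r), ⇑B = Z ∘ e :=
    ⟨basisOfLinearIndependentOfCardEqFinrank' _ hb (by simp), by simp⟩
  rw [← hB]
  have hB' (i : Fin r) : B i = Z (e i) := congrFun hB i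
  have hne (i : Fin r) : Nonempty (posPart Z B i) :=
    ⟨e i, (mem_posPart_iff B Z i _).2 ⟨hB' i ▸ basis_mem_flag B (Nat.lt_succ_self _), by
      rw [← hB']; simp⟩⟩
  obtain ⟨μ, p, d, h⟩ := exists_isPartialPiece B Z hne r le_rfl
  obtain ⟨ι, _, X, c, ε, hX, hXi, hc, hε, hT, hagree, hsign⟩ := h.exists_spline
  have hμ : IsLayer ⊤ μ := flag_top B ▸ h.isLayer
  have := isAddLeftInvariant_of_isLayer_top hμ
  have := hμ.isFiniteMeasureOnCompacts
  have hpos (i : Fin r) : Pointed (sub Z (posPart Z B i)) :=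
    ⟨B.coord i, fun k => ((mem_posPart_iff B Z i k).1 k.2).2⟩
  have hneg (i : Fin r) : Pointed (-sub Z (negPart Z B i)) :=
    ⟨B.coord i, fun k => by
      have := ((mem_negPart_iff B Z i k).1 k.2).2
      rw [Pi.neg_apply, map_neg, neg_pos]
      exact this⟩
  refine ⟨⟨hpos, fun i => (hpos i).neg, fun i => by simpa using (hneg i).neg, hneg,
    fun i => ⟨_, isConvolution_plus B Z i⟩, fun i => ⟨_, isConvolution_minus B Z i⟩,
    h.iterConvolvable_R, h.iterConvolvable_T⟩, ?_⟩
  -- By uniqueness of Haar measure `μ` is a multiple of Lebesgue measure, nonzero because `μ` is;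
  -- the factor is absorbed into the polynomial.
  let a : NNReal := Measure.addHaarScalarFactor μ volume
  have ha : μ = a • volume := Measure.isAddLeftInvariant_eq_smul μ volume
  have ha0 : (a : ℝ) ≠ 0 := fun h0 => h.ne_zero (by
    rw [ha, NNReal.coe_eq_zero.1 h0, zero_smul])
  have hpoly (φ : Test r) : ∫ x, φ x * MvPolynomial.eval x p ∂μ =
      polyDistr (MvPolynomial.C (a : ℝ) * p) φ := by
    rw [polyDistr_apply]
    conv_lhs => rw [ha, integral_smul_nnreal_measure, NNReal.smul_def, smul_eq_mul,
      ← integral_const_mul]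
    simp [mul_left_comm]
  obtain ⟨c₀, hc₀, htau⟩ := tau_mem_narrowCone B hε
  refine ⟨MvPolynomial.C (a : ℝ) * p, ?_, ?_, ?_, fun hZ => ?_⟩
  · refine DFunLike.ext _ _ fun φ => ?_
    rw [← hpoly, ← hμ.distrOfDensity_apply, ← h.iterConv_R]
    rfl
  -- The strict sign of `c * p` at `tau B c₀` rules out `p = 0`.
  · refine mul_ne_zero (by simpa using ha0) fun h0 => ?_
    have := hsign (tau B c₀) (by rw [flag_top]; trivial) (htau c₀ le_rfl)
    simp [h0] at this
  · refine ⟨narrowConvexCone B ε, isOpen_narrowCone B r ε,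
      narrowCone_subset_listCone B Z hB' ε, ⟨c₀, hc₀, htau⟩, fun φ hφ => ?_⟩
    have h1 := hagree φ φ.continuous φ.hasCompactSupport
      fun z _ hz => hφ (subset_tsupport _ hz)
    rw [← spline_apply hX] at h1
    rw [← hpoly, TB]
    refine (DFunLike.congr_fun hT φ).trans (h1.trans ?_)
    simp only [mul_comm]
  · have h1 := h.degree_add
    have h2 := sum_card_posPart_add_card_negPart B Z hZ
    have h3 : d = N - r := by
      have : d + r = N := h1.trans h2
      omega
    simpa [h3] using (MvPolynomial.isHomogeneous_C _ (a : ℝ)).mul h.isHomogeneous
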